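/- Let $\Bbbk$ be a commutative ring and let $A = A_{\bar 0}\oplus A_{\bar 1}$ be a symmetric Frobenius superalgebra over $\Bbbk$: an associative unital superalgebra with a $\Bbbk$-linear trace map $\mathrm{tr}\colon A\to\Bbbk$, homogeneous of parity $\sigma\in\mathbb Z/2$, such that $\mathrm{tr}(ab)=(-1)^{\bar a\bar b}\mathrm{tr}(ba)$ for homogeneous $a,b$, and with a finite homogeneous basis $B$ and a dual basis $\{b^\vee : b\in B\}$ satisfying $\mathrm{tr}(b^\vee c)=\delta_{b,c}$ for $b,c\in B$. Consider strict monoidal $\Bbbk$-linear supercategories with one generating object $\uparrow$. Composition is denoted $\circ$, and the super interchange law is $(f'\otimes g)\circ(f\otimes g')=(-1)^{\bar f\bar g}(f'\circ f)\otimes(g\circ g')$. The generating morphisms are taken among tokens $t_a\in\mathrm{End}(\uparrow)$ for $a\in A$, with the parity of $a$; a dot $x\in\mathrm{End}(\uparrow)$ of parity $\sigma$; and an even crossing $u\in\mathrm{End}(\uparrow^{\otimes 2})$. The relations are taken among the following. (T) $t_1=1$, $\ t_{\lambda a+\mu b}=\lambda t_a+\mu t_b$, $\ t_{ab}=t_a\circ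 t_b$, for $a,b\in A$ and $\lambda,\mu\in\Bbbk$. (C) $u\circ u=0$, $\ (u\otimes1)\circ(1\otimes u)\circ(u\otimes1)=(1\otimes u)\circ(u\otimes1)\circ(1\otimes u)$, $\ u\circ(t_a\otimes1)=(1\otimes t_a)\circ u$, $\ u\circ(1\otimes t_a)=(t_a\otimes1)\circ u$, for $a\in A$. (D) $t_a\circ x=(-1)^{\sigma\bar a}\,x\circ t_a$ for homogeneous $a\in A$. (DC) $u\circ(x\otimes1)-(1\otimes x)\circ u=\tau$ and $(x\otimes1)\circ u-u\circ(1\otimes x)=(-1)^{\sigma}\tau$, where $\tau=\sum_{b\in B}(-1)^{\sigma\bar b}\,t_b\otimes t_{b^\vee}$. The Frobenius polynomial algebra $\mathrm{Pol}_n(A)$ is $\mathrm{End}(\uparrow^{\otimes n})$ in the supercategory generated by tokens and dots subject to (T) and (D). The nilCoxeter algebra $\mathrm{NC}_n(A)$ is $\mathrm{End}(\uparrow^{\otimes n})$ in the one generated by tokens and crossings subject to (T) and (C); this makes sense for every superalgebra $A$, and in particular for the purely even superalgebra $\Bbbk$. The Frobenius nilHecke algebra $\mathrm{NH}_n(A)$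 is $\mathrm{End}(\uparrow^{\otimes n})$ in the one generated by tokens, dots and crossings subject to (T), (C), (D) and (DC). Let $\mathrm{Pol}_n(A)\to\mathrm{NH}_n(A)$ and $\mathrm{NC}_n(\Bbbk)\to\mathrm{NH}_n(A)$ be the natural algebra homomorphisms, induced by sending tokens, dots and crossings to tokens, dots and crossings (a token labelled by $c\in\Bbbk$ goes to the token labelled by $c\cdot 1_A$). Then, for every $n\in\mathbb N$, the $\Bbbk$-linear map $$\mathrm{Pol}_n(A)\otimes_{\Bbbk}\mathrm{NC}_n(\Bbbk)\longrightarrow\mathrm{NH}_n(A),\qquad f\otimes z\longmapsto fz,$$ where $f$ and $z$ are viewed in $\mathrm{NH}_n(A)$ through the natural homomorphisms, is an isomorphism of $\Bbbk$-modules. -/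

import Mathlib

universe u v w

open scoped TensorProduct

namespace FrobNH

/-! ### Strict monoidal linear supercategories given by endomorphism generators and relations

Every category below has one generating object, so its objects are the tensor powers of that object
and are indexed by natural numbers. All generating morphisms are endomorphisms, so there are no
nonzero morphisms between different objects and it suffices to describe endomorphisms. -/

/-- Formal `k`-linear string diagrams on `n` strands built from generators `G m` of endomorphisms of
the `m`-th tensor power. `comp f g` is the vertical composition (`f` above `g`), and `tensor h f g`
is the horizontal composition (`f` to the left of `g`). -/
inductive Diag (k : Type u) (G : ℕ → Type v) : ℕ → Type (max u v)
  | gen {n : ℕ} (g : G n) : Diag k G n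
  | ident (n : ℕ) : Diag k G n
  | comp {n : ℕ} (f g : Diag k G n) : Diag k G n
  | tensor {m n l : ℕ} (h : m + n = l) (f : Diag k G m) (g : Diag k G n) : Diag k G l
  | zero (n : ℕ) : Diag k G n
  | add {n : ℕ} (f g : Diag k G n) : Diag k G n
  | smul {n : ℕ} (c : k) (f : Diag k G n) : Diag k G n

namespace Diag

variable {k : Type u} {G : ℕ → Type v} {G' : ℕ → Type w} {n : ℕ}

instance : Zero (Diag k G n) := ⟨Diag.zero n⟩
instance : Add (Diag k G n) := ⟨Diag.add⟩
instance : SMul k (Diag k G n) := ⟨Diag.smul⟩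

/-- Replace every generator of a diagram by a generator of another kind. -/
def map (φ : ∀ n, G n → G' n) : ∀ {n : ℕ}, Diag k G n → Diag k G' n
  | _, gen g => gen (φ _ g)
  | _, ident n => ident n
  | _, comp f g => comp (map φ f) (map φ g)
  | _, tensor h f g => tensor h (map φ f) (map φ g)
  | _, zero n => zero n
  | _, add f g => add (map φ f) (map φ g)
  | _, smul c f => smul c (map φ f)

/-- `Homog par p f`: the diagram `f` is homogeneous of parity `p`, where `par n g p` says that the
generator `g` is homogeneous of parity `p`. -/
inductive Homog (par : ∀ n, G n → ZMod 2 → Prop) : ∀ {n : ℕ}, ZMod 2 → Diag k G n → Prop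
  | gen {n : ℕ} {g : G n} {p : ZMod 2} : par n g p → Homog par p (gen g)
  | ident (n : ℕ) : Homog par 0 (ident n)
  | comp {n : ℕ} {f g : Diag k G n} {p q : ZMod 2} :
      Homog par p f → Homog par q g → Homog par (p + q) (comp f g)
  | tensor {m n l : ℕ} (h : m + n = l) {f : Diag k G m} {g : Diag k G n} {p q : ZMod 2} :
      Homog par p f → Homog par q g → Homog par (p + q) (tensor h f g)
  | zero {n : ℕ} (p : ZMod 2) : Homog par p (0 : Diag k G n)
  | add {n : ℕ} {f g : Diag k G n} {p : ZMod 2} :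
      Homog par p f → Homog par p g → Homog par p (f + g)
  | smul {n : ℕ} (c : k) {f : Diag k G n} {p : ZMod 2} :
      Homog par p f → Homog par p (c • f)

theorem Homog.map {par : ∀ n, G n → ZMod 2 → Prop} {par' : ∀ n, G' n → ZMod 2 → Prop}
    {φ : ∀ n, G n → G' n} (hpar : ∀ n g p, par n g p → par' n (φ n g) p) {n : ℕ} {p : ZMod 2}
    {f : Diag k G n} (h : Homog par p f) : Homog par' p (f.map φ) := by
  induction h with
  | gen h => exact .gen (hpar _ _ _ h)
  | ident n => exact .ident n
  | comp _ _ h₁ h₂ => exact .comp h₁ h₂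
  | tensor h _ _ h₁ h₂ => exact .tensor h h₁ h₂
  | zero p => exact .zero p
  | add _ _ h₁ h₂ => exact .add h₁ h₂
  | smul c _ h => exact .smul c h

end Diag

/-- The sign `(-1)^(p q)`. -/
def sgn (k : Type u) [CommRing k] (p q : ZMod 2) : k := (-1) ^ (p.val * q.val)

/-- Data presenting a strict monoidal `k`-linear supercategory with one generating object: generating
endomorphisms, their parities, and relations between endomorphisms. -/
structure Presentation (k : Type u) where
  /-- generating endomorphisms of the `n`-th tensor power of the generating object -/
  Gen : ℕ → Type v
  /-- `par n g p`: the generator `g` is homogeneous of parity `p` -/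
  par : ∀ n, Gen n → ZMod 2 → Prop
  /-- the defining relations -/
  rel : ∀ n, Diag k Gen n → Diag k Gen n → Prop

namespace Presentation

variable {k : Type u} [CommRing k]

open Diag

/-- The identifications of diagrams forced by the defining relations and by the axioms of a strict
monoidal `k`-linear supercategory, closed under all the operations. (The equivalence relation
generated by these identifications is taken when the quotient is formed.) -/
inductive Step (P : Presentation.{u, v} k) : ∀ {n : ℕ}, Diag k P.Gen n → Diag k P.Gen n → Prop
  -- the defining relations
  | rel {n : ℕ} {f g : Diag k P.Gen n} : P.rel n f g → Step P f g
  -- congruence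
  | comp_left {n : ℕ} {f f' : Diag k P.Gen n} (g : Diag k P.Gen n) :
      Step P f f' → Step P (comp f g) (comp f' g)
  | comp_right {n : ℕ} (f : Diag k P.Gen n) {g g' : Diag k P.Gen n} :
      Step P g g' → Step P (comp f g) (comp f g')
  | tensor_left {m n l : ℕ} (h : m + n = l) {f f' : Diag k P.Gen m} (g : Diag k P.Gen n) :
      Step P f f' → Step P (tensor h f g) (tensor h f' g)
  | tensor_right {m n l : ℕ} (h : m + n = l) (f : Diag k P.Gen m) {g g' : Diag k P.Gen n} :
      Step P g g' → Step P (tensor h f g) (tensor h f g')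
  | add_left {n : ℕ} {f f' : Diag k P.Gen n} (g : Diag k P.Gen n) :
      Step P f f' → Step P (f + g) (f' + g)
  | add_right {n : ℕ} (f : Diag k P.Gen n) {g g' : Diag k P.Gen n} :
      Step P g g' → Step P (f + g) (f + g')
  | smul_congr {n : ℕ} (c : k) {f f' : Diag k P.Gen n} :
      Step P f f' → Step P (c • f) (c • f')
  -- morphism spaces are `k`-modules
  | add_comm {n : ℕ} (f g : Diag k P.Gen n) : Step P (f + g) (g + f)
  | add_assoc {n : ℕ} (f g e : Diag k P.Gen n) : Step P (f + g + e) (f + (g + e))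
  | zero_add {n : ℕ} (f : Diag k P.Gen n) : Step P (0 + f) f
  | zero_smul {n : ℕ} (f : Diag k P.Gen n) : Step P ((0 : k) • f) 0
  | one_smul {n : ℕ} (f : Diag k P.Gen n) : Step P ((1 : k) • f) f
  | mul_smul {n : ℕ} (c d : k) (f : Diag k P.Gen n) : Step P ((c * d) • f) (c • (d • f))
  | add_smul {n : ℕ} (c d : k) (f : Diag k P.Gen n) : Step P ((c + d) • f) (c • f + d • f)
  | smul_add {n : ℕ} (c : k) (f g : Diag k P.Gen n) : Step P (c • (f + g)) (c • f + c • g)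
  -- composition is associative, unital and bilinear
  | comp_assoc {n : ℕ} (f g e : Diag k P.Gen n) :
      Step P (comp (comp f g) e) (comp f (comp g e))
  | id_comp {n : ℕ} (f : Diag k P.Gen n) : Step P (comp (ident n) f) f
  | comp_id {n : ℕ} (f : Diag k P.Gen n) : Step P (comp f (ident n)) f
  | add_comp {n : ℕ} (f f' g : Diag k P.Gen n) :
      Step P (comp (f + f') g) (comp f g + comp f' g)
  | comp_add {n : ℕ} (f g g' : Diag k P.Gen n) :
      Step P (comp f (g + g')) (comp f g + comp f g')
  | smul_comp {n : ℕ} (c : k) (f g : Diag k P.Gen n) :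
      Step P (comp (c • f) g) (c • comp f g)
  | comp_smul {n : ℕ} (c : k) (f g : Diag k P.Gen n) :
      Step P (comp f (c • g)) (c • comp f g)
  -- the tensor product is strictly associative, strictly unital and bilinear
  | tensor_assoc {a b c ab bc abc : ℕ} (h₁ : a + b = ab) (h₂ : ab + c = abc) (h₃ : b + c = bc)
      (h₄ : a + bc = abc) (f : Diag k P.Gen a) (g : Diag k P.Gen b) (e : Diag k P.Gen c) :
      Step P (tensor h₂ (tensor h₁ f g) e) (tensor h₄ f (tensor h₃ g e))
  | id_tensor {n : ℕ} (h : 0 + n = n) (f : Diag k P.Gen n) : Step P (tensor h (ident 0) f) f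
  | tensor_id {n : ℕ} (h : n + 0 = n) (f : Diag k P.Gen n) : Step P (tensor h f (ident 0)) f
  | add_tensor {m n l : ℕ} (h : m + n = l) (f f' : Diag k P.Gen m) (g : Diag k P.Gen n) :
      Step P (tensor h (f + f') g) (tensor h f g + tensor h f' g)
  | tensor_add {m n l : ℕ} (h : m + n = l) (f : Diag k P.Gen m) (g g' : Diag k P.Gen n) :
      Step P (tensor h f (g + g')) (tensor h f g + tensor h f g')
  | smul_tensor {m n l : ℕ} (h : m + n = l) (c : k) (f : Diag k P.Gen m) (g : Diag k P.Gen n) :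
      Step P (tensor h (c • f) g) (c • tensor h f g)
  | tensor_smul {m n l : ℕ} (h : m + n = l) (c : k) (f : Diag k P.Gen m) (g : Diag k P.Gen n) :
      Step P (tensor h f (c • g)) (c • tensor h f g)
  -- identities are monoidal, and the super interchange law
  | id_tensor_id {m n l : ℕ} (h : m + n = l) : Step P (tensor h (ident m) (ident n)) (ident l)
  | interchange {m n l : ℕ} (h : m + n = l) (f' f : Diag k P.Gen m) (g g' : Diag k P.Gen n)
      {p q : ZMod 2} : Homog P.par p f → Homog P.par q g →
      Step P (comp (tensor h f' g) (tensor h f g'))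
        (sgn k p q • tensor h (comp f' f) (comp g g'))

/-- The endomorphism algebra of the `n`-th tensor power of the generating object. -/
def EndAlg (P : Presentation.{u, v} k) (n : ℕ) : Type (max u v) :=
  Quot (Step P (n := n))

namespace EndAlg

variable {P : Presentation.{u, v} k} {n : ℕ}

/-- The endomorphism represented by a diagram. -/
def mk (f : Diag k P.Gen n) : P.EndAlg n := Quot.mk _ f

instance : Zero (P.EndAlg n) := ⟨mk 0⟩

instance : One (P.EndAlg n) := ⟨mk (Diag.ident n)⟩

instance : Add (P.EndAlg n) :=
  ⟨Quot.map₂ (fun f g => f + g) (fun f _ _ h => Step.add_right f h)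
    (fun _ _ g h => Step.add_left g h)⟩

instance : Mul (P.EndAlg n) :=
  ⟨Quot.map₂ Diag.comp (fun f _ _ h => Step.comp_right f h) (fun _ _ g h => Step.comp_left g h)⟩

instance : SMul k (P.EndAlg n) :=
  ⟨fun c => Quot.map (fun f => c • f) (fun _ _ h => Step.smul_congr c h)⟩

instance : Neg (P.EndAlg n) := ⟨fun f => (-1 : k) • f⟩

theorem mk_eq {f g : Diag k P.Gen n} (h : Step P f g) : (mk f : P.EndAlg n) = mk g :=
  Quot.sound h

theorem ind {p : P.EndAlg n → Prop} (h : ∀ f, p (mk f)) (x : P.EndAlg n) : p x :=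
  Quot.ind h x

theorem mk_add (f g : Diag k P.Gen n) : (mk (f + g) : P.EndAlg n) = mk f + mk g := rfl

theorem mk_comp (f g : Diag k P.Gen n) : (mk (Diag.comp f g) : P.EndAlg n) = mk f * mk g := rfl

theorem mk_smul (c : k) (f : Diag k P.Gen n) : (mk (c • f) : P.EndAlg n) = c • mk f := rfl

theorem mk_zero : (mk 0 : P.EndAlg n) = 0 := rfl

theorem mk_id : (mk (Diag.ident n) : P.EndAlg n) = 1 := rfl

protected theorem zero_smul' (x : P.EndAlg n) : (0 : k) • x = 0 := by
  induction x using ind with | h f => exact mk_eq (Step.zero_smul f)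

protected theorem add_smul' (c d : k) (x : P.EndAlg n) : (c + d) • x = c • x + d • x := by
  induction x using ind with | h f => exact mk_eq (Step.add_smul c d f)

protected theorem one_smul' (x : P.EndAlg n) : (1 : k) • x = x := by
  induction x using ind with | h f => exact mk_eq (Step.one_smul f)

protected theorem smul_mul' (c : k) (x y : P.EndAlg n) : c • x * y = c • (x * y) := by
  induction x using ind with | h f =>
  induction y using ind with | h g => exact mk_eq (Step.smul_comp c f g)

protected theorem mul_smul' (c : k) (x y : P.EndAlg n) : x * c • y = c • (x * y) := by
  induction x using ind with | h f =>
  induction y using ind with | h g => exact mk_eq (Step.comp_smul c f g)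

protected theorem add_comm' (x y : P.EndAlg n) : x + y = y + x := by
  induction x using ind with | h f =>
  induction y using ind with | h g => exact mk_eq (Step.add_comm f g)

protected theorem zero_add' (x : P.EndAlg n) : 0 + x = x := by
  induction x using ind with | h f => exact mk_eq (Step.zero_add f)

instance : Ring (P.EndAlg n) where
  add_assoc x y z := by
    induction x using ind with | h f =>
    induction y using ind with | h g =>
    induction z using ind with | h e => exact mk_eq (Step.add_assoc f g e)
  zero_add := EndAlg.zero_add'
  add_zero x := by rw [EndAlg.add_comm', EndAlg.zero_add']
  add_comm := EndAlg.add_comm'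
  left_distrib x y z := by
    induction x using ind with | h f =>
    induction y using ind with | h g =>
    induction z using ind with | h e => exact mk_eq (Step.comp_add f g e)
  right_distrib x y z := by
    induction x using ind with | h f =>
    induction y using ind with | h g =>
    induction z using ind with | h e => exact mk_eq (Step.add_comp f g e)
  zero_mul x := by
    rw [← EndAlg.zero_smul' (0 : P.EndAlg n), EndAlg.smul_mul', EndAlg.zero_smul',
      EndAlg.zero_smul']
  mul_zero x := by
    rw [← EndAlg.zero_smul' (0 : P.EndAlg n), EndAlg.mul_smul', EndAlg.zero_smul',
      EndAlg.zero_smul']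
  mul_assoc x y z := by
    induction x using ind with | h f =>
    induction y using ind with | h g =>
    induction z using ind with | h e => exact mk_eq (Step.comp_assoc f g e)
  one_mul x := by
    induction x using ind with | h f => exact mk_eq (Step.id_comp f)
  mul_one x := by
    induction x using ind with | h f => exact mk_eq (Step.comp_id f)
  nsmul := nsmulRec
  zsmul := zsmulRec
  neg_add_cancel x := by
    change (-1 : k) • x + x = 0
    have h := EndAlg.add_smul' (-1) 1 x
    rw [neg_add_cancel, EndAlg.zero_smul', EndAlg.one_smul'] at h
    exact h.symm

instance : Module k (P.EndAlg n) where
  one_smul := EndAlg.one_smul'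
  mul_smul c d x := by
    induction x using ind with | h f => exact mk_eq (Step.mul_smul c d f)
  smul_zero c := by
    have h : mk ((c * 0) • (0 : Diag k P.Gen n)) = c • (0 : k) • (0 : P.EndAlg n) :=
      mk_eq (Step.mul_smul c 0 0)
    rw [mk_smul, mul_zero, mk_zero, EndAlg.zero_smul'] at h
    exact h.symm
  smul_add c x y := by
    induction x using ind with | h f =>
    induction y using ind with | h g => exact mk_eq (Step.smul_add c f g)
  add_smul := EndAlg.add_smul'
  zero_smul := EndAlg.zero_smul'

instance : Algebra k (P.EndAlg n) :=
  Algebra.ofModule EndAlg.smul_mul' EndAlg.mul_smul'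

end EndAlg

section Functor

variable {P : Presentation.{u, v} k} {Q : Presentation.{u, w} k} {φ : ∀ n, P.Gen n → Q.Gen n}

theorem step_map (hpar : ∀ n g p, P.par n g p → Q.par n (φ n g) p)
    (hrel : ∀ n f g, P.rel n f g → Q.rel n (f.map φ) (g.map φ)) {n : ℕ}
    {f g : Diag k P.Gen n} (h : Step P f g) : Step Q (f.map φ) (g.map φ) := by
  induction h with
  | rel h => exact .rel (hrel _ _ _ h)
  | comp_left g _ h => exact .comp_left _ h
  | comp_right f _ h => exact .comp_right _ h
  | tensor_left e g _ h => exact .tensor_left e _ h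
  | tensor_right e f _ h => exact .tensor_right e _ h
  | add_left g _ h => exact .add_left _ h
  | add_right f _ h => exact .add_right _ h
  | smul_congr c _ h => exact .smul_congr c h
  | add_comm f g => exact .add_comm _ _
  | add_assoc f g e => exact .add_assoc _ _ _
  | zero_add f => exact .zero_add _
  | zero_smul f => exact .zero_smul _
  | one_smul f => exact .one_smul _
  | mul_smul c d f => exact .mul_smul _ _ _
  | add_smul c d f => exact .add_smul _ _ _
  | smul_add c f g => exact .smul_add _ _ _
  | comp_assoc f g e => exact .comp_assoc _ _ _
  | id_comp f => exact .id_comp _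
  | comp_id f => exact .comp_id _
  | add_comp f f' g => exact .add_comp _ _ _
  | comp_add f g g' => exact .comp_add _ _ _
  | smul_comp c f g => exact .smul_comp _ _ _
  | comp_smul c f g => exact .comp_smul _ _ _
  | tensor_assoc h₁ h₂ h₃ h₄ f g e => exact .tensor_assoc h₁ h₂ h₃ h₄ _ _ _
  | id_tensor h f => exact .id_tensor h _
  | tensor_id h f => exact .tensor_id h _
  | add_tensor h f f' g => exact .add_tensor h _ _ _
  | tensor_add h f g g' => exact .tensor_add h _ _ _
  | smul_tensor h c f g => exact .smul_tensor h _ _ _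
  | tensor_smul h c f g => exact .tensor_smul h _ _ _
  | id_tensor_id h => exact .id_tensor_id h
  | interchange h f' f g g' hf hg =>
      exact .interchange h _ _ _ _ (hf.map hpar) (hg.map hpar)

/-- The algebra homomorphism on endomorphism algebras induced by the strict monoidal functor that
sends each generating morphism `g` to `φ g`. -/
def EndAlg.map (φ : ∀ n, P.Gen n → Q.Gen n) (hpar : ∀ n g p, P.par n g p → Q.par n (φ n g) p)
    (hrel : ∀ n f g, P.rel n f g → Q.rel n (f.map φ) (g.map φ)) (n : ℕ) :
    P.EndAlg n →ₐ[k] Q.EndAlg n :=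
  AlgHom.ofLinearMap
    { toFun := Quot.map (fun f => f.map φ) (fun _ _ h => step_map hpar hrel h)
      map_add' := fun x y => by
        induction x using EndAlg.ind with | h f =>
        induction y using EndAlg.ind with | h g => rfl
      map_smul' := fun c x => by
        induction x using EndAlg.ind with | h f => rfl }
    rfl
    (fun x y => by
      induction x using EndAlg.ind with | h f =>
      induction y using EndAlg.ind with | h g => rfl)

end Functor

end Presentation

/-! ### Symmetric Frobenius superalgebras -/

/-- The structure of a symmetric Frobenius superalgebra on the superalgebra `A` with even and odd
parts `𝒜 0` and `𝒜 1`: a trace map of parity `trp`, and a homogeneous basis together with its dual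
basis, both indexed by `ι`. -/
structure SymmetricFrobenius (k : Type u) [CommRing k] {A : Type v} [Ring A] [Algebra k A]
    (𝒜 : ZMod 2 → Submodule k A) (ι : Type w) where
  /-- the parity of the trace map -/
  trp : ZMod 2
  /-- the trace map -/
  tr : A →ₗ[k] k
  /-- the trace map is homogeneous of parity `trp`, its codomain being purely even -/
  tr_homog : ∀ p, p ≠ trp → ∀ a ∈ 𝒜 p, tr a = 0
  tr_symm : ∀ p q, ∀ a ∈ 𝒜 p, ∀ b ∈ 𝒜 q, tr (a * b) = sgn k p q * tr (b * a)
  /-- a homogeneous basis -/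
  basis : Module.Basis ι k A
  /-- the parities of the basis elements -/
  par : ι → ZMod 2
  basis_mem : ∀ i, basis i ∈ 𝒜 (par i)
  /-- the dual basis -/
  dual : Module.Basis ι k A
  tr_dual_self : ∀ i, tr (dual i * basis i) = 1
  tr_dual_ne : ∀ i j, i ≠ j → tr (dual i * basis j) = 0

/-! ### The relations -/

section Relations

variable {k : Type u} [CommRing k] {A : Type v} [Ring A] [Algebra k A] {G : ℕ → Type w}

open Diag

/-- Tokens define a homomorphism of algebras from `A`. -/
inductive TokenRel (tok : A → Diag k G 1) : ∀ n, Diag k G n → Diag k G n → Prop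
  | one : TokenRel tok 1 (tok 1) (ident 1)
  | linear (c d : k) (a b : A) : TokenRel tok 1 (c • tok a + d • tok b) (tok (c • a + d • b))
  | mul (a b : A) : TokenRel tok 1 (comp (tok a) (tok b)) (tok (a * b))

/-- Crossings satisfy the nilCoxeter relations, and tokens slide through crossings. -/
inductive CrossRel (tok : A → Diag k G 1) (cross : Diag k G 2) :
    ∀ n, Diag k G n → Diag k G n → Prop
  | sq : CrossRel tok cross 2 (comp cross cross) 0
  | braid : CrossRel tok cross 3
      (comp (tensor rfl cross (ident 1)) (comp (tensor rfl (ident 1) cross) (tensor rfl cross (ident 1))))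
      (comp (tensor rfl (ident 1) cross) (comp (tensor rfl cross (ident 1)) (tensor rfl (ident 1) cross)))
  | slide_left (a : A) : CrossRel tok cross 2
      (comp cross (tensor rfl (tok a) (ident 1))) (comp (tensor rfl (ident 1) (tok a)) cross)
  | slide_right (a : A) : CrossRel tok cross 2
      (comp cross (tensor rfl (ident 1) (tok a))) (comp (tensor rfl (tok a) (ident 1)) cross)

/-- Tokens and dots on the same strand supercommute, the dot being of parity `t`. -/
inductive DotTokenRel (𝒜 : ZMod 2 → Submodule k A) (t : ZMod 2) (tok : A → Diag k G 1)
    (dot : Diag k G 1) : ∀ n, Diag k G n → Diag k G n → Prop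
  | comm (p : ZMod 2) (a : A) : a ∈ 𝒜 p →
      DotTokenRel 𝒜 t tok dot 1 (comp (tok a) dot) (sgn k t p • comp dot (tok a))

/-- The teleporter: the sum over the basis elements `b` of `(-1)^(trp * par b)` times the diagram
with the token `b` on the left strand and the token of its dual on the right strand. -/
noncomputable def teleporter {𝒜 : ZMod 2 → Submodule k A} {ι : Type*} [Fintype ι]
    (F : SymmetricFrobenius k 𝒜 ι) (tok : A → Diag k G 1) : Diag k G 2 :=
  ((Finset.univ : Finset ι).toList.map fun i =>
    sgn k F.trp (F.par i) • tensor rfl (tok (F.basis i)) (tok (F.dual i))).sum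

/-- Dots slide through crossings up to teleporters. -/
inductive DotCrossRel {𝒜 : ZMod 2 → Submodule k A} {ι : Type*} [Fintype ι]
    (F : SymmetricFrobenius k 𝒜 ι) (tok : A → Diag k G 1) (dot : Diag k G 1) (cross : Diag k G 2) :
    ∀ n, Diag k G n → Diag k G n → Prop
  | left : DotCrossRel F tok dot cross 2
      (comp cross (tensor rfl dot (ident 1)) + (-1 : k) • comp (tensor rfl (ident 1) dot) cross)
      (teleporter F tok)
  | right : DotCrossRel F tok dot cross 2
      (comp (tensor rfl dot (ident 1)) cross + (-1 : k) • comp cross (tensor rfl (ident 1) dot))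
      (sgn k F.trp 1 • teleporter F tok)

end Relations

/-! ### The categories -/

/-- Generators of the Frobenius polynomial category. -/
inductive PolGen (A : Type v) : ℕ → Type v
  | token (a : A) : PolGen A 1
  | dot : PolGen A 1

/-- Generators of the Frobenius nilCoxeter category. -/
inductive NilCoxGen (A : Type v) : ℕ → Type v
  | token (a : A) : NilCoxGen A 1
  | cross : NilCoxGen A 2

/-- Generators of the Frobenius nilHecke category. -/
inductive NilHeckeGen (A : Type v) : ℕ → Type v
  | token (a : A) : NilHeckeGen A 1
  | dot : NilHeckeGen A 1
  | cross : NilHeckeGen A 2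

section Categories

variable {k : Type u} [CommRing k] {A : Type v} [Ring A] [Algebra k A]
  (𝒜 : ZMod 2 → Submodule k A)

/-- Tokens have the parity of their label, dots have parity `t`. -/
inductive PolPar (t : ZMod 2) : ∀ n, PolGen A n → ZMod 2 → Prop
  | token (p : ZMod 2) (a : A) : a ∈ 𝒜 p → PolPar t 1 (.token a) p
  | dot : PolPar t 1 .dot t

/-- Tokens have the parity of their label, crossings are even. -/
inductive NilCoxPar : ∀ n, NilCoxGen A n → ZMod 2 → Prop
  | token (p : ZMod 2) (a : A) : a ∈ 𝒜 p → NilCoxPar 1 (.token a) p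
  | cross : NilCoxPar 2 .cross 0

/-- Tokens have the parity of their label, dots have parity `t`, crossings are even. -/
inductive NilHeckePar (t : ZMod 2) : ∀ n, NilHeckeGen A n → ZMod 2 → Prop
  | token (p : ZMod 2) (a : A) : a ∈ 𝒜 p → NilHeckePar t 1 (.token a) p
  | dot : NilHeckePar t 1 .dot t
  | cross : NilHeckePar t 2 .cross 0

/-- The Frobenius polynomial category of `A`; only the parity `t` of the trace map matters. -/
def polCat (t : ZMod 2) : Presentation.{u, v} k where
  Gen := PolGen A
  par := PolPar 𝒜 t
  rel n f g := TokenRel (fun a => .gen (.token a)) n f g ∨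
    DotTokenRel 𝒜 t (fun a => .gen (.token a)) (.gen .dot) n f g

/-- The Frobenius nilCoxeter category of `A`. -/
def nilCoxCat : Presentation.{u, v} k where
  Gen := NilCoxGen A
  par := NilCoxPar 𝒜
  rel n f g := TokenRel (fun a => .gen (.token a)) n f g ∨
    CrossRel (fun a : A => .gen (.token a)) (.gen .cross) n f g

/-- The Frobenius nilHecke category of `A`. -/
def nilHeckeCat {𝒜 : ZMod 2 → Submodule k A} {ι : Type*} [Fintype ι]
    (F : SymmetricFrobenius k 𝒜 ι) : Presentation.{u, v} k where
  Gen := NilHeckeGen A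
  par := NilHeckePar 𝒜 F.trp
  rel n f g := TokenRel (fun a => .gen (.token a)) n f g ∨
    CrossRel (fun a : A => .gen (.token a)) (.gen .cross) n f g ∨
    DotTokenRel 𝒜 F.trp (fun a => .gen (.token a)) (.gen .dot) n f g ∨
    DotCrossRel F (fun a => .gen (.token a)) (.gen .dot) (.gen .cross) n f g

end Categories

/-- The ground ring as a purely even superalgebra. -/
def evenGrading (k : Type u) [CommRing k] : ZMod 2 → Submodule k k :=
  fun p => if p = 0 then ⊤ else ⊥

section Algebras

variable {k : Type u} [CommRing k] {A : Type v} [Ring A] [Algebra k A]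
  {𝒜 : ZMod 2 → Submodule k A} {ι : Type w} [Fintype ι] (F : SymmetricFrobenius k 𝒜 ι) (n : ℕ)

/-- The Frobenius polynomial algebra. -/
abbrev PolAlg : Type (max u v) := (polCat 𝒜 F.trp).EndAlg n

/-- The Frobenius nilHecke algebra. -/
abbrev NilHeckeAlg : Type (max u v) := (nilHeckeCat F).EndAlg n

/-- The Frobenius nilCoxeter algebra of a superalgebra `A`. -/
abbrev NilCoxAlg (𝒜 : ZMod 2 → Submodule k A) (n : ℕ) : Type (max u v) := (nilCoxCat 𝒜).EndAlg n

/-- The natural map from the Frobenius polynomial algebra to the Frobenius nilHecke algebra, sending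
tokens to tokens and dots to dots. -/
def polToNilHecke : PolAlg F n →ₐ[k] NilHeckeAlg F n :=
  Presentation.EndAlg.map (P := polCat 𝒜 F.trp) (Q := nilHeckeCat F)
    (fun _ g => match g with
      | .token a => .token a
      | .dot => .dot)
    (fun n g p h => by
      cases h with
      | token p a h => exact .token p a h
      | dot => exact .dot)
    (fun n f g h => by
      rcases h with h | h
      · left
        cases h with
        | one => exact .one
        | linear c d a b => exact .linear c d a b
        | mul a b => exact .mul a b
      · right; right; left
        cases h with
        | comm p a h => exact .comm p a h)
    n

/-- The natural map from the nilCoxeter algebra of the ground ring to the Frobenius nilHecke algebra,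
sending crossings to crossings and the token labelled by a scalar `c` to the token labelled by
`c` times the unit. -/
def nilCoxToNilHecke [GradedAlgebra 𝒜] : NilCoxAlg (evenGrading k) n →ₐ[k] NilHeckeAlg F n :=
  Presentation.EndAlg.map (P := nilCoxCat (evenGrading k)) (Q := nilHeckeCat F)
    (fun _ g => match g with
      | .token c => .token (algebraMap k A c)
      | .cross => .cross)
    (fun n g p h => by
      cases h with
      | token p c h =>
        refine .token p _ ?_
        by_cases hp : p = 0
        · subst hp
          exact SetLike.algebraMap_mem_graded 𝒜 c
        · simp only [evenGrading, hp, if_false, Submodule.mem_bot] at h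
          simp [h]
      | cross => exact .cross)
    (fun n f g h => by
      rcases h with h | h
      · left
        cases h with
        | one =>
          have h := TokenRel.one (k := k) (A := A) (G := NilHeckeGen A)
            (tok := fun a => .gen (.token a))
          rwa [← map_one (algebraMap k A)] at h
        | linear c d a b =>
          have h := TokenRel.linear (k := k) (A := A) (G := NilHeckeGen A)
            (tok := fun a => .gen (.token a)) c d (algebraMap k A a) (algebraMap k A b)
          have e : c • algebraMap k A a + d • algebraMap k A b = algebraMap k A (c • a + d • b) := by
            simp [Algebra.smul_def]
          rwa [e] at h
        | mul a b =>
          have h := TokenRel.mul (k := k) (A := A) (G := NilHeckeGen A)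
            (tok := fun a => .gen (.token a)) (algebraMap k A a) (algebraMap k A b)
          rwa [← map_mul] at h
      · right; left
        cases h with
        | sq => exact .sq
        | braid => exact .braid
        | slide_left a => exact .slide_left (algebraMap k A a)
        | slide_right a => exact .slide_right (algebraMap k A a))
    n

end Algebras

end FrobNH

-- The multiplication map is split by an action of $\mathrm{NH}_n(A)$ on
-- $\mathrm{Pol}_n(A)\otimes\mathrm{NC}_n(\Bbbk)$, which imitates left multiplication on the
-- products $fz$.
--
-- Diagrams become algebra as follows. When every generator splits into homogeneous parts, the
-- endomorphism algebra on $n$ strands is generated by the generators placed at each position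
-- (`mem_subalgebra_of_genAt_mem`). Any values at the positions that satisfy the local relations and
-- supercommute on disjoint strands extend to an algebra homomorphism (`IsModel.lift`). Thus each of
-- the three algebras is treated through generators and relations.
--
-- In $\mathrm{NH}_n(A)$ a crossing moves past a polynomial by $u_if=s_i(f)u_i+\partial_i(f)$, where
-- $s_i$ permutes strands and $\partial_i(fg)=s_i(f)\partial_i(g)+\partial_i(f)g$
-- (`IsCrossSystem.mul_map`). Hence the image of the multiplication map is stable under left
-- multiplication by all generators. It contains $1$, so the map is surjective.
--
-- For injectivity, polynomials act on the first tensor factor by left multiplication, and $u_i$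
-- acts by $f\otimes z\mapsto s_i(f)\otimes u_iz+\partial_i(f)\otimes z$. The operator $\partial_i$
-- exists because $f\mapsto\begin{pmatrix}s_i(f)&\partial_i(f)\\0&f\end{pmatrix}$ respects the
-- relations of $\mathrm{Pol}_n(A)$; this rests on the symmetry and sliding properties of the
-- teleporter. The nilCoxeter relations of the action are not verified on all polynomials. The
-- difference $D$ of the two sides of such a relation commutes with polynomials up to a permutation
-- of strands, so it vanishes once it kills all $1\otimes z$, where the relation is that of
-- $\mathrm{NC}_n(\Bbbk)$ (`eq_zero_of_mul_polAct`). Finally $fz$ sends $1\otimes1$ to $f\otimes z$,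
-- which gives a left inverse.

universe x

namespace FrobNH

/-! ### Arithmetic of the signs. -/

section Sign

variable {k : Type u} [CommRing k]

theorem sgn_comm (p q : ZMod 2) : sgn k p q = sgn k q p := by
  rw [sgn, sgn, mul_comm]

@[simp] theorem sgn_zero_left (p : ZMod 2) : sgn k 0 p = 1 := by simp [sgn]

@[simp] theorem sgn_zero_right (p : ZMod 2) : sgn k p 0 = 1 := by simp [sgn]

theorem sgn_one_one : sgn k 1 1 = -1 := by simp [sgn, ZMod.val_one]

theorem zmod_two_cases (p : ZMod 2) : p = 0 ∨ p = 1 := by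
  revert p; decide

theorem sgn_mul_self (p q : ZMod 2) : sgn k p q * sgn k p q = 1 := by
  rw [sgn, ← mul_pow]; simp

/-- The exponent uses representatives in $\{0,1\}$, which are not additive; the only failure,
$1+1=0$, is absorbed by the square of a sign being $1$. -/
theorem sgn_add_left (p q r : ZMod 2) : sgn k (p + q) r = sgn k p r * sgn k q r := by
  have h : (1 : ZMod 2) + 1 = 0 := by decide
  rcases zmod_two_cases p with rfl | rfl <;> rcases zmod_two_cases q with rfl | rfl <;>
    simp [h, sgn_mul_self]

theorem sgn_add_right (p q r : ZMod 2) : sgn k p (q + r) = sgn k p q * sgn k p r := by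
  rw [sgn_comm, sgn_add_left, sgn_comm q, sgn_comm r]

theorem sgn_self (p : ZMod 2) : sgn k p p = sgn k p 1 := by
  rcases zmod_two_cases p with rfl | rfl <;> simp

end Sign

/-! ### Evaluation of diagrams in an algebra -/

namespace Diag

variable {k : Type u} [CommRing k] {G : ℕ → Type v} {R : Type w} [Ring R] [Algebra k R]

/-- Evaluate a diagram whose leftmost strand has number `j`, given the value `φ m j g` of every
generator `g` on `m` strands whose leftmost strand has number `j`. -/
def eval (φ : ∀ m, ℕ → G m → R) : ∀ {m : ℕ}, ℕ → Diag k G m → R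
  | m, j, gen g => φ m j g
  | _, _, ident _ => 1
  | _, j, comp f g => eval φ j f * eval φ j g
  | _, j, tensor (m := m) _ f g => eval φ j f * eval φ (j + m) g
  | _, _, zero _ => 0
  | _, j, add f g => eval φ j f + eval φ j g
  | _, j, smul c f => c • eval φ j f

variable (φ : ∀ m, ℕ → G m → R) {m : ℕ} (j : ℕ)

@[simp] theorem eval_gen (g : G m) : (gen g : Diag k G m).eval φ j = φ m j g := rfl

@[simp] theorem eval_ident : (ident m : Diag k G m).eval φ j = 1 := rfl

@[simp] theorem eval_comp (f g : Diag k G m) :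
    (comp f g).eval φ j = f.eval φ j * g.eval φ j := rfl

@[simp] theorem eval_tensor {n l : ℕ} (h : m + n = l) (f : Diag k G m) (g : Diag k G n) :
    (tensor h f g).eval φ j = f.eval φ j * g.eval φ (j + m) := rfl

@[simp] theorem eval_zero : (0 : Diag k G m).eval φ j = 0 := rfl

@[simp] theorem eval_add (f g : Diag k G m) :
    (f + g).eval φ j = f.eval φ j + g.eval φ j := rfl

@[simp] theorem eval_smul (c : k) (f : Diag k G m) : (c • f).eval φ j = c • f.eval φ j := rfl

theorem eval_list_sum (l : List (Diag k G m)) :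
    l.sum.eval φ j = (l.map fun f => f.eval φ j).sum := by
  induction l with
  | nil => rfl
  | cons f l ih => simp [ih]

end Diag

/-- `y` commutes past `x` up to the scalar `c`. -/
def CommUpTo {k : Type u} [CommRing k] {R : Type w} [Ring R] [Algebra k R] (c : k) (x y : R) :
    Prop :=
  y * x = c • (x * y)

namespace CommUpTo

variable {k : Type u} [CommRing k] {R : Type w} [Ring R] [Algebra k R] {c d : k} {x x' y y' : R}

theorem one_left : CommUpTo (1 : k) 1 y := by simp [CommUpTo]

theorem one_right : CommUpTo (1 : k) x 1 := by simp [CommUpTo]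

theorem zero_left : CommUpTo c 0 y := by simp [CommUpTo]

theorem zero_right : CommUpTo c x 0 := by simp [CommUpTo]

theorem mul_left (h : CommUpTo c x y) (h' : CommUpTo d x' y) :
    CommUpTo (c * d) (x * x') y := by
  unfold CommUpTo at *
  rw [← mul_assoc, h, smul_mul_assoc, mul_assoc, h', mul_smul_comm, smul_smul, mul_assoc]

theorem mul_right (h : CommUpTo c x y) (h' : CommUpTo d x y') :
    CommUpTo (c * d) x (y * y') := by
  unfold CommUpTo at *
  rw [mul_assoc, h', mul_smul_comm, ← mul_assoc, h, smul_mul_assoc, smul_smul, mul_assoc,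
    mul_comm c d]

theorem add_left (h : CommUpTo c x y) (h' : CommUpTo c x' y) : CommUpTo c (x + x') y := by
  unfold CommUpTo at *
  rw [mul_add, h, h', add_mul, smul_add]

theorem add_right (h : CommUpTo c x y) (h' : CommUpTo c x y') : CommUpTo c x (y + y') := by
  unfold CommUpTo at *
  rw [add_mul, h, h', mul_add, smul_add]

theorem smul_left (e : k) (h : CommUpTo c x y) : CommUpTo c (e • x) y := by
  unfold CommUpTo at *
  rw [mul_smul_comm, h, smul_mul_assoc, smul_comm]

theorem smul_right (e : k) (h : CommUpTo c x y) : CommUpTo c x (e • y) := by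
  unfold CommUpTo at *
  rw [smul_mul_assoc, h, mul_smul_comm, smul_comm]

end CommUpTo

/-! ### Models of a presentation and the homomorphisms they induce. -/

namespace Presentation

open Diag

variable {k : Type u} [CommRing k]

/-- Values of the generators at all positions on `n` strands satisfy the defining relations, and
values of generators on disjoint sets of strands supercommute. -/
structure IsModel (P : Presentation.{u, v} k) (n : ℕ) {R : Type w} [Ring R] [Algebra k R]
    (φ : ∀ m, ℕ → P.Gen m → R) : Prop where
  comm : ∀ {m m' : ℕ} (g : P.Gen m) (g' : P.Gen m') (p q : ZMod 2) (j j' : ℕ),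
    P.par m g p → P.par m' g' q → j + m ≤ j' → j' + m' ≤ n →
      CommUpTo (sgn k p q) (φ m j g) (φ m' j' g')
  rel : ∀ (m : ℕ) (f g : Diag k P.Gen m) (j : ℕ), P.rel m f g → j + m ≤ n →
    f.eval φ j = g.eval φ j

namespace IsModel

variable {P : Presentation.{u, v} k} {n : ℕ} {R : Type w} [Ring R] [Algebra k R]
  {φ : ∀ m, ℕ → P.Gen m → R}

theorem eval_comm_gen (hφ : P.IsModel n φ) {m m' : ℕ} {f : Diag k P.Gen m} (g' : P.Gen m')
    {p q : ZMod 2} (hf : Homog P.par p f) (hg : P.par m' g' q) {j j' : ℕ} (h : j + m ≤ j')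
    (h' : j' + m' ≤ n) : CommUpTo (sgn k p q) (f.eval φ j) (φ m' j' g') := by
  induction hf generalizing j with
  | gen hp => exact hφ.comm _ _ _ _ _ _ hp hg h h'
  | ident m => simpa using CommUpTo.one_left
  | comp _ _ h₁ h₂ => rw [sgn_add_left]; exact (h₁ h).mul_left (h₂ h)
  | tensor e _ _ h₁ h₂ => rw [sgn_add_left]; exact (h₁ (by omega)).mul_left (h₂ (by omega))
  | zero p => exact CommUpTo.zero_left
  | add _ _ h₁ h₂ => exact (h₁ h).add_left (h₂ h)
  | smul c _ h₁ => exact (h₁ h).smul_left c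

/-- Supercommutation spreads from generators to homogeneous diagrams because signs are biadditive in
the parities; `eval_comm_gen` treats the left diagram and this induction the right one. -/
theorem eval_comm (hφ : P.IsModel n φ) {m m' : ℕ} {f : Diag k P.Gen m} {g : Diag k P.Gen m'}
    {p q : ZMod 2} (hf : Homog P.par p f) (hg : Homog P.par q g) {j j' : ℕ} (h : j + m ≤ j')
    (h' : j' + m' ≤ n) : CommUpTo (sgn k p q) (f.eval φ j) (g.eval φ j') := by
  induction hg generalizing j' with
  | gen hp => exact hφ.eval_comm_gen _ hf hp h h'
  | ident m => simpa using CommUpTo.one_right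
  | comp _ _ h₁ h₂ => rw [sgn_add_right]; exact (h₁ h h').mul_right (h₂ h h')
  | tensor e _ _ h₁ h₂ =>
    rw [sgn_add_right]; exact (h₁ h (by omega)).mul_right (h₂ (by omega) (by omega))
  | zero p => exact CommUpTo.zero_right
  | add _ _ h₁ h₂ => exact (h₁ h h').add_right (h₂ h h')
  | smul c _ h₁ => exact (h₁ h h').smul_right c

/-- Only two kinds of identification need the model: the defining relations use `rel`, and the
interchange law uses `comm`. All the others hold for evaluation in any algebra. -/
theorem eval_step (hφ : P.IsModel n φ) {m : ℕ} {f g : Diag k P.Gen m} (hs : Step P f g) {j : ℕ}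
    (hj : j + m ≤ n) : f.eval φ j = g.eval φ j := by
  induction hs generalizing j with
  | rel h => exact hφ.rel _ _ _ _ h hj
  | comp_left g _ h => simp [h hj]
  | comp_right f _ h => simp [h hj]
  | tensor_left e g _ h => rw [eval_tensor, eval_tensor, h (by omega)]
  | tensor_right e f _ h => rw [eval_tensor, eval_tensor, h (by omega)]
  | add_left g _ h => simp [h hj]
  | add_right f _ h => simp [h hj]
  | smul_congr c _ h => simp [h hj]
  | add_comm f g => simp [_root_.add_comm]
  | add_assoc f g e => simp [_root_.add_assoc]
  | zero_add f => simp
  | zero_smul f => simp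
  | one_smul f => simp
  | mul_smul c d f => simp [smul_smul]
  | add_smul c d f => simp [_root_.add_smul]
  | smul_add c f g => simp
  | comp_assoc f g e => simp [mul_assoc]
  | id_comp f => simp
  | comp_id f => simp
  | add_comp f f' g => simp [add_mul]
  | comp_add f g g' => simp [mul_add]
  | smul_comp c f g => simp
  | comp_smul c f g => simp
  | tensor_assoc h₁ h₂ h₃ h₄ f g e => subst h₁; simp [mul_assoc, _root_.add_assoc]
  | id_tensor h f => simp
  | tensor_id h f => simp
  | add_tensor h f f' g => simp [add_mul]
  | tensor_add h f g g' => simp [mul_add]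
  | smul_tensor h c f g => simp
  | tensor_smul h c f g => simp
  | id_tensor_id h => simp
  | interchange h f' f g g' hf hg =>
    have e := hφ.eval_comm hf hg (j := j) le_rfl (by omega)
    unfold CommUpTo at e
    simp only [eval_comp, eval_tensor, eval_smul]
    rw [mul_assoc, ← mul_assoc (eval φ _ g), e, smul_mul_assoc, mul_smul_comm]
    simp only [mul_assoc]

/-- The algebra homomorphism out of the endomorphism algebra given by a model. -/
def lift (hφ : P.IsModel n φ) : P.EndAlg n →ₐ[k] R :=
  AlgHom.ofLinearMap
    { toFun := Quot.lift (fun f => f.eval φ 0) fun _ _ h => hφ.eval_step h (by omega)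
      map_add' := fun x y => by
        induction x using EndAlg.ind with | h f =>
        induction y using EndAlg.ind with | h g => rfl
      map_smul' := fun c x => by
        induction x using EndAlg.ind with | h f => rfl }
    rfl
    (fun x y => by
      induction x using EndAlg.ind with | h f =>
      induction y using EndAlg.ind with | h g => rfl)

theorem lift_mk (hφ : P.IsModel n φ) (f : Diag k P.Gen n) :
    hφ.lift (EndAlg.mk f) = f.eval φ 0 := rfl

end IsModel

/-! ### The tensor product of endomorphisms -/

/-- Every generator is a sum of an even and an odd endomorphism. -/
def HomogSpanned (P : Presentation.{u, v} k) : Prop :=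
  ∀ m (g : P.Gen m), ∃ f₀ f₁ : Diag k P.Gen m, Homog P.par 0 f₀ ∧ Homog P.par 1 f₁ ∧
    (EndAlg.mk (gen g) : P.EndAlg m) = EndAlg.mk f₀ + EndAlg.mk f₁

namespace EndAlg

variable {P : Presentation.{u, v} k} {m n l : ℕ}

/-- The horizontal composition of endomorphisms. -/
def tens (h : m + n = l) : P.EndAlg m → P.EndAlg n → P.EndAlg l :=
  Quot.map₂ (Diag.tensor h) (fun f _ _ e => Step.tensor_right h f e)
    (fun _ _ g e => Step.tensor_left h g e)

theorem mk_tensor (h : m + n = l) (f : Diag k P.Gen m) (g : Diag k P.Gen n) :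
    (mk (Diag.tensor h f g) : P.EndAlg l) = tens h (mk f) (mk g) := rfl

theorem add_tens (h : m + n = l) (x x' : P.EndAlg m) (y : P.EndAlg n) :
    tens h (x + x') y = tens h x y + tens h x' y := by
  induction x using ind with | h f =>
  induction x' using ind with | h f' =>
  induction y using ind with | h g => exact mk_eq (Step.add_tensor h f f' g)

theorem tens_add (h : m + n = l) (x : P.EndAlg m) (y y' : P.EndAlg n) :
    tens h x (y + y') = tens h x y + tens h x y' := by
  induction x using ind with | h f =>
  induction y using ind with | h g =>
  induction y' using ind with | h g' => exact mk_eq (Step.tensor_add h f g g')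

theorem smul_tens (h : m + n = l) (c : k) (x : P.EndAlg m) (y : P.EndAlg n) :
    tens h (c • x) y = c • tens h x y := by
  induction x using ind with | h f =>
  induction y using ind with | h g => exact mk_eq (Step.smul_tensor h c f g)

theorem tens_smul (h : m + n = l) (c : k) (x : P.EndAlg m) (y : P.EndAlg n) :
    tens h x (c • y) = c • tens h x y := by
  induction x using ind with | h f =>
  induction y using ind with | h g => exact mk_eq (Step.tensor_smul h c f g)

theorem tens_assoc {a b c ab bc abc : ℕ} (h₁ : a + b = ab) (h₂ : ab + c = abc) (h₃ : b + c = bc)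
    (h₄ : a + bc = abc) (x : P.EndAlg a) (y : P.EndAlg b) (z : P.EndAlg c) :
    tens h₂ (tens h₁ x y) z = tens h₄ x (tens h₃ y z) := by
  induction x using ind with | h f =>
  induction y using ind with | h g =>
  induction z using ind with | h e => exact mk_eq (Step.tensor_assoc h₁ h₂ h₃ h₄ f g e)

theorem one_tens_one (h : m + n = l) : tens h (1 : P.EndAlg m) (1 : P.EndAlg n) = 1 :=
  mk_eq (Step.id_tensor_id h)

theorem one_zero_tens (h : 0 + n = n) (x : P.EndAlg n) : tens h (1 : P.EndAlg 0) x = x := by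
  induction x using ind with | h f => exact mk_eq (Step.id_tensor h f)

theorem tens_one_zero (h : n + 0 = n) (x : P.EndAlg n) : tens h x (1 : P.EndAlg 0) = x := by
  induction x using ind with | h f => exact mk_eq (Step.tensor_id h f)

theorem interchange (h : m + n = l) (x : P.EndAlg m) {f : Diag k P.Gen m} {g : Diag k P.Gen n}
    (y : P.EndAlg n) {p q : ZMod 2} (hf : Homog P.par p f) (hg : Homog P.par q g) :
    tens h x (mk g) * tens h (mk f) y = sgn k p q • tens h (x * mk f) (mk g * y) := by
  induction x using ind with | h f' =>
  induction y using ind with | h g' => exact mk_eq (Step.interchange h f' f g g' hf hg)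

theorem tens_one_mul_one_tens (h : m + n = l) (x : P.EndAlg m) (y : P.EndAlg n) :
    tens h x 1 * tens h 1 y = tens h x y := by
  have e := interchange (P := P) h x y (Homog.ident m) (Homog.ident n)
  simpa [mk_id] using e

/-- The interchange law is available only for homogeneous diagrams. This decomposition lets its
consequences be extended to arbitrary endomorphisms by additivity. -/
theorem exists_homog (hP : P.HomogSpanned) (x : P.EndAlg n) :
    ∃ f₀ f₁ : Diag k P.Gen n, Homog P.par 0 f₀ ∧ Homog P.par 1 f₁ ∧ x = mk f₀ + mk f₁ := by
  have two : (1 : ZMod 2) + 1 = 0 := by decide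
  induction x using ind with | h f =>
  induction f with
  | gen g => exact hP _ g
  | ident n => exact ⟨.ident n, 0, .ident n, .zero 1, by simp [mk_zero]⟩
  | comp f g ihf ihg =>
    obtain ⟨f₀, f₁, hf₀, hf₁, ef⟩ := ihf
    obtain ⟨g₀, g₁, hg₀, hg₁, eg⟩ := ihg
    refine ⟨comp f₀ g₀ + comp f₁ g₁, comp f₀ g₁ + comp f₁ g₀,
      .add (by simpa using hf₀.comp hg₀) (by simpa [two] using hf₁.comp hg₁),
      .add (by simpa using hf₀.comp hg₁) (by simpa using hf₁.comp hg₀), ?_⟩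
    simp only [mk_comp, mk_add, ef, eg, mul_add, add_mul]
    abel
  | tensor h f g ihf ihg =>
    obtain ⟨f₀, f₁, hf₀, hf₁, ef⟩ := ihf
    obtain ⟨g₀, g₁, hg₀, hg₁, eg⟩ := ihg
    refine ⟨tensor h f₀ g₀ + tensor h f₁ g₁, tensor h f₀ g₁ + tensor h f₁ g₀,
      .add (by simpa using hf₀.tensor h hg₀) (by simpa [two] using hf₁.tensor h hg₁),
      .add (by simpa using hf₀.tensor h hg₁) (by simpa using hf₁.tensor h hg₀), ?_⟩
    simp only [mk_tensor, mk_add, ef, eg, tens_add, add_tens]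
    abel
  | zero n => exact ⟨0, 0, .zero 0, .zero 1, by simp only [mk_zero, add_zero]; rfl⟩
  | add f g ihf ihg =>
    obtain ⟨f₀, f₁, hf₀, hf₁, ef⟩ := ihf
    obtain ⟨g₀, g₁, hg₀, hg₁, eg⟩ := ihg
    refine ⟨f₀ + g₀, f₁ + g₁, hf₀.add hg₀, hf₁.add hg₁, ?_⟩
    change mk f + mk g = _
    rw [ef, eg, mk_add, mk_add]
    abel
  | smul c f ihf =>
    obtain ⟨f₀, f₁, hf₀, hf₁, ef⟩ := ihf
    refine ⟨c • f₀, c • f₁, hf₀.smul c, hf₁.smul c, ?_⟩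
    change c • mk f = _
    rw [ef, smul_add, mk_smul, mk_smul]

/-- The identity is even, so the interchange sign is trivial on each homogeneous part of `x`; `y`
need not be split. -/
theorem one_tens_mul (hP : P.HomogSpanned) (h : m + n = l) (x y : P.EndAlg n) :
    tens h (1 : P.EndAlg m) x * tens h 1 y = tens h 1 (x * y) := by
  obtain ⟨f₀, f₁, h₀, h₁, rfl⟩ := exists_homog hP x
  have e₀ := interchange h 1 y (Homog.ident m) h₀
  have e₁ := interchange h 1 y (Homog.ident m) h₁
  simp only [mk_id, sgn_zero_left, one_smul, mul_one] at e₀ e₁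
  rw [tens_add, add_mul, e₀, e₁, add_mul, tens_add]

theorem mul_tens_one (hP : P.HomogSpanned) (h : m + n = l) (x y : P.EndAlg m) :
    tens h x (1 : P.EndAlg n) * tens h y 1 = tens h (x * y) 1 := by
  obtain ⟨f₀, f₁, h₀, h₁, rfl⟩ := exists_homog hP y
  have e₀ := interchange h x 1 h₀ (Homog.ident n)
  have e₁ := interchange h x 1 h₁ (Homog.ident n)
  simp only [mk_id, sgn_zero_right, one_smul, mul_one] at e₀ e₁
  rw [add_tens, mul_add, e₀, e₁, mul_add, add_tens]

/-! ### Endomorphisms placed on some of the strands -/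

/-- Place an endomorphism on the strands `j, …, j + m - 1` of `n` strands. -/
def place (j r : ℕ) (h : j + m + r = n) (x : P.EndAlg m) : P.EndAlg n :=
  tens h (tens rfl (1 : P.EndAlg j) x) (1 : P.EndAlg r)

theorem place_one (j r : ℕ) (h : j + m + r = n) : place j r h (1 : P.EndAlg m) = 1 := by
  rw [place, one_tens_one, one_tens_one]

theorem place_mul (hP : P.HomogSpanned) (j r : ℕ) (h : j + m + r = n) (x y : P.EndAlg m) :
    place j r h (x * y) = place j r h x * place j r h y := by
  rw [place, place, place, mul_tens_one hP, one_tens_mul hP]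

theorem place_add (j r : ℕ) (h : j + m + r = n) (x y : P.EndAlg m) :
    place j r h (x + y) = place j r h x + place j r h y := by
  rw [place, tens_add, add_tens]; rfl

theorem place_smul (j r : ℕ) (h : j + m + r = n) (c : k) (x : P.EndAlg m) :
    place j r h (c • x) = c • place j r h x := by
  rw [place, tens_smul, smul_tens]; rfl

theorem place_zero (j r : ℕ) (h : j + m + r = n) : place j r h (0 : P.EndAlg m) = 0 := by
  rw [← zero_smul k (0 : P.EndAlg m), place_smul, zero_smul]

/-- Write $x\otimes y=(x\otimes1)\circ(1\otimes y)$, which involves no sign, and regroup the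
identity strands by strict associativity. -/
theorem place_tens (hP : P.HomogSpanned) {a b : ℕ} (e : a + b = m) (j r : ℕ)
    (h : j + m + r = n) (x : P.EndAlg a) (y : P.EndAlg b) :
    place j r h (tens e x y) =
      place j (b + r) (by omega) x * place (j + a) r (by omega) y := by
  rw [← tens_one_mul_one_tens, place_mul hP]
  subst e
  congr 1
  · rw [place, place, ← one_tens_one (P := P) (rfl : b + r = b + r),
      ← tens_assoc (rfl : (j + a) + b = j + a + b) (by omega) rfl,
      tens_assoc rfl (rfl : (j + a) + b = j + a + b) rfl (by omega)]
    grind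
  · rw [place, place, ← one_tens_one (P := P) (rfl : j + a = j + a),
      tens_assoc rfl (rfl : (j + a) + b = j + a + b) rfl (by omega)]
    grind

end EndAlg

/-! ### Generators at all positions, and the universal model. -/

open EndAlg

variable {k : Type u} [CommRing k] {P : Presentation.{u, v} k} {n : ℕ}

/-- The endomorphism of `n` strands given by the generator `g` on `m` strands starting at `j`. -/
def genAt (P : Presentation.{u, v} k) (n : ℕ) (m j : ℕ) (g : P.Gen m) : P.EndAlg n :=
  -- The value $0$ is a default for positions that do not fit. In particular a crossing indexed by
  -- the last strand is $0$, so statements about crossings carry a hypothesis `(i : ℕ) + 1 = j` with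
  -- `j : Fin n`.
  if h : j + m ≤ n then place j (n - j - m) (by omega) (EndAlg.mk (gen g)) else 0

theorem genAt_eq {m j r : ℕ} (h : j + m + r = n) (g : P.Gen m) :
    P.genAt n m j g = place j r h (EndAlg.mk (gen g)) := by
  obtain rfl : r = n - j - m := by omega
  rw [genAt, dif_pos (by omega)]

theorem eval_genAt (hP : P.HomogSpanned) {m : ℕ} (f : Diag k P.Gen m) {j r : ℕ}
    (h : j + m + r = n) : f.eval (P.genAt n) j = place j r h (EndAlg.mk f) := by
  induction f generalizing j r with
  | gen g => exact genAt_eq h g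
  | ident n => exact (place_one j r h).symm
  | comp f g ihf ihg => rw [eval_comp, ihf h, ihg h, mk_comp, place_mul hP]
  | tensor e f g ihf ihg =>
    rw [eval_tensor, mk_tensor, place_tens hP e, ← ihf, ← ihg]
  | zero n => exact (place_zero j r h).symm
  | add f g ihf ihg =>
    change f.eval _ j + g.eval _ j = place j r h (EndAlg.mk f + EndAlg.mk g)
    rw [ihf h, ihg h, place_add]
  | smul c f ihf =>
    change c • f.eval _ j = place j r h (c • EndAlg.mk f)
    rw [ihf h, place_smul]

/-- Every endomorphism is thereby a noncommutative polynomial in the placed generators, which is the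
source of all generation statements below. -/
theorem mk_eq_eval_genAt (hP : P.HomogSpanned) (f : Diag k P.Gen n) :
    (EndAlg.mk f : P.EndAlg n) = f.eval (P.genAt n) 0 := by
  rw [eval_genAt hP f (j := 0) (r := 0) (by omega), place,
    tens_assoc rfl _ (add_zero n) (zero_add n), tens_one_zero, one_zero_tens]

theorem mem_subalgebra_of_genAt_mem (hP : P.HomogSpanned) (S : Subalgebra k (P.EndAlg n))
    (hS : ∀ m j (g : P.Gen m), j + m ≤ n → P.genAt n m j g ∈ S) (x : P.EndAlg n) : x ∈ S := by
  have key : ∀ {m : ℕ} (f : Diag k P.Gen m) (j : ℕ), j + m ≤ n → f.eval (P.genAt n) j ∈ S := by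
    intro m f
    induction f with
    | gen g => exact fun j h => hS _ j g h
    | ident n => exact fun j h => S.one_mem
    | comp f g ihf ihg => exact fun j h => S.mul_mem (ihf j h) (ihg j h)
    | tensor e f g ihf ihg =>
      exact fun j h => S.mul_mem (ihf j (by omega)) (ihg _ (by omega))
    | zero n => exact fun j h => S.zero_mem
    | add f g ihf ihg => exact fun j h => S.add_mem (ihf j h) (ihg j h)
    | smul c f ihf => exact fun j h => S.smul_mem (ihf j h) c
  induction x using EndAlg.ind with | h f =>
  rw [mk_eq_eval_genAt hP]
  exact key f 0 (by omega)

/-- The placed generators are the universal model. For two disjoint generators the strands are cut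
just after the first one, and the interchange law is applied across the cut; identities are even, so
only the parities of the generators enter the sign. -/
theorem isModel_genAt (hP : P.HomogSpanned) : P.IsModel n (P.genAt n) where
  comm {m m'} g g' p q j j' hg hg' h h' := by
    obtain ⟨c, rfl⟩ := Nat.exists_eq_add_of_le h
    obtain ⟨r, rfl⟩ := Nat.exists_eq_add_of_le h'
    have e₁ : P.genAt (j + m + c + m' + r) m j g =
        tens (show (j + m) + (c + m' + r) = _ by omega)
          (EndAlg.mk (tensor rfl (ident j) (gen g))) 1 :=
      genAt_eq (by omega) g
    have e₂ : P.genAt (j + m + c + m' + r) m' (j + m + c) g' =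
        tens (show (j + m) + (c + m' + r) = _ by omega) 1
          (EndAlg.mk (tensor rfl (tensor rfl (ident c) (gen g')) (ident r))) := by
      rw [genAt_eq (rfl : j + m + c + m' + r = _), place, mk_tensor, mk_tensor, mk_id, mk_id,
        ← tens_assoc (show (j + m) + (c + m') = j + m + c + m' by omega) rfl,
        ← tens_assoc (rfl : (j + m) + c = _) (by omega), one_tens_one]
    have e := EndAlg.interchange (show (j + m) + (c + m' + r) = j + m + c + m' + r by omega) 1 1
      (Homog.tensor rfl (Homog.ident j) (Homog.gen hg))
      (Homog.tensor rfl (Homog.tensor rfl (Homog.ident c) (Homog.gen hg')) (Homog.ident r))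
    rw [← e₁, ← e₂, one_mul, mul_one, ← tens_one_mul_one_tens, ← e₁, ← e₂] at e
    simpa [CommUpTo] using e
  rel m f g j hr h := by
    rw [eval_genAt hP f (show j + m + (n - j - m) = n by omega),
      eval_genAt hP g (show j + m + (n - j - m) = n by omega), mk_eq (Step.rel hr)]

theorem IsModel.lift_genAt {R : Type w} [Ring R] [Algebra k R] {φ : ∀ m, ℕ → P.Gen m → R}
    (hφ : P.IsModel n φ) {m j : ℕ} (h : j + m ≤ n) (g : P.Gen m) :
    hφ.lift (P.genAt n m j g) = φ m j g := by
  rw [genAt_eq (show j + m + (n - j - m) = n by omega)]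
  change hφ.lift (EndAlg.mk (tensor _ (tensor rfl (ident j) (gen g)) (ident _))) = _
  rw [hφ.lift_mk]
  simp

theorem EndAlg.map_genAt {Q : Presentation.{u, w} k} {φ : ∀ n, P.Gen n → Q.Gen n}
    (hpar : ∀ n g p, P.par n g p → Q.par n (φ n g) p)
    (hrel : ∀ n f g, P.rel n f g → Q.rel n (f.map φ) (g.map φ)) {m j : ℕ} (h : j + m ≤ n)
    (g : P.Gen m) : EndAlg.map φ hpar hrel n (P.genAt n m j g) = Q.genAt n m j (φ m g) := by
  rw [genAt_eq (show j + m + (n - j - m) = n by omega),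
    genAt_eq (show j + m + (n - j - m) = n by omega)]
  rfl

end Presentation

/-! ### The dual basis of a symmetric Frobenius superalgebra -/

section Graded

variable {k : Type u} [CommRing k] {A : Type v} [Ring A] [Algebra k A]

theorem exists_eq_add_mem (𝒜 : ZMod 2 → Submodule k A) [GradedAlgebra 𝒜] (q : ZMod 2) (a : A) :
    ∃ b ∈ 𝒜 q, ∃ c ∈ 𝒜 (q + 1), a = b + c := by
  classical
  have h : a = ((DirectSum.decompose 𝒜 a) 0 : A) + (DirectSum.decompose 𝒜 a) 1 := by
    have e : ∑ i, ((DirectSum.decompose 𝒜 a) i : A) = a := by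
      conv_rhs => rw [← DirectSum.sum_support_decompose 𝒜 a]
      symm
      apply Finset.sum_subset (Finset.subset_univ _)
      intro i _ hi
      simpa using hi
    conv_lhs => rw [← e]
    exact Fin.sum_univ_two _
  have two : (1 : ZMod 2) + 1 = 0 := by decide
  rcases zmod_two_cases q with rfl | rfl
  · exact ⟨_, SetLike.coe_mem _, _, SetLike.coe_mem _, h⟩
  · exact ⟨_, SetLike.coe_mem _, _, two ▸ SetLike.coe_mem _, (add_comm _ _).trans h.symm |>.symm⟩

end Graded

namespace SymmetricFrobenius

variable {k : Type u} [CommRing k] {A : Type v} [Ring A] [Algebra k A]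
  {𝒜 : ZMod 2 → Submodule k A} {ι : Type w} [Fintype ι] (F : SymmetricFrobenius k 𝒜 ι)

omit [Fintype ι] in
theorem tr_dual_basis [DecidableEq ι] (i j : ι) :
    F.tr (F.dual i * F.basis j) = if i = j then 1 else 0 := by
  split_ifs with h
  · subst h; exact F.tr_dual_self i
  · exact F.tr_dual_ne i j h

theorem sum_tr_smul_dual (y : A) : ∑ j, F.tr (y * F.basis j) • F.dual j = y := by
  classical
  conv_rhs => rw [← F.dual.sum_repr y]
  refine Finset.sum_congr rfl fun j _ => ?_
  have e : ∀ c : ι → k, F.tr ((∑ l, c l • F.dual l) * F.basis j) = c j := fun c => by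
    simp [Finset.sum_mul, F.tr_dual_basis]
  rw [← e fun l => F.dual.repr y l, F.dual.sum_repr]

theorem sum_tr_smul_basis (y : A) : ∑ j, F.tr (F.dual j * y) • F.basis j = y := by
  classical
  conv_rhs => rw [← F.basis.sum_repr y]
  refine Finset.sum_congr rfl fun j _ => ?_
  have e : ∀ c : ι → k, F.tr (F.dual j * ∑ l, c l • F.basis l) = c j := fun c => by
    simp [Finset.mul_sum, F.tr_dual_basis]
  rw [← e fun l => F.basis.repr y l, F.basis.sum_repr]

theorem eq_zero_of_tr_mul_basis {y : A} (h : ∀ j, F.tr (y * F.basis j) = 0) : y = 0 := by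
  rw [← F.sum_tr_smul_dual y]
  simp [h]

variable [GradedAlgebra 𝒜]

omit [Fintype ι] in
theorem tr_mul_eq_zero {p q : ZMod 2} (h : p + q ≠ F.trp) {a b : A} (ha : a ∈ 𝒜 p)
    (hb : b ∈ 𝒜 q) : F.tr (a * b) = 0 :=
  F.tr_homog _ h _ (SetLike.mul_mem_graded ha hb)

/-- The component of the wrong parity pairs to zero with each basis element, either by the parity of
the trace or by duality, and the trace form is nondegenerate. -/
theorem dual_mem (i : ι) : F.dual i ∈ 𝒜 (F.par i + F.trp) := by
  obtain ⟨b, hb, c, hc, e⟩ := exists_eq_add_mem 𝒜 (F.par i + F.trp) (F.dual i)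
  suffices c = 0 by rw [e, this, add_zero]; exact hb
  refine F.eq_zero_of_tr_mul_basis fun j => ?_
  by_cases hj : F.par j = F.par i
  · refine F.tr_mul_eq_zero ?_ hc (F.basis_mem j)
    rw [hj]; generalize F.par i = p; generalize F.trp = t; revert p t; decide
  · have h₁ : F.tr (F.dual i * F.basis j) = 0 := F.tr_dual_ne i j (by rintro rfl; exact hj rfl)
    have h₂ : F.tr (b * F.basis j) = 0 := by
      refine F.tr_mul_eq_zero ?_ hb (F.basis_mem j)
      revert hj
      generalize F.par i = p; generalize F.par j = q; generalize F.trp = t; revert p q t; decide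
    rwa [e, add_mul, map_add, h₂, zero_add] at h₁

variable {R : Type x} [AddCommGroup R] [Module k R]

/-- Expanding $ba$ in the basis and $ac^\vee$ in the dual basis gives the coefficients
$\mathrm{tr}(c^\vee ba)$ and $\mathrm{tr}(ac^\vee b)$. Supersymmetry relates them, and where they
can be nonzero $\bar a=\bar b+\bar c$, which makes the signs agree. -/
theorem sum_basis_mul_dual (B : A →ₗ[k] A →ₗ[k] R) {p : ZMod 2} {a : A} (ha : a ∈ 𝒜 p) :
    ∑ b, sgn k (F.trp + p) (F.par b) • B (F.basis b * a) (F.dual b) =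
      ∑ c, sgn k (F.trp + p) (F.par c) • B (F.basis c) (a * F.dual c) := by
  have h₁ : ∀ b, B (F.basis b * a) (F.dual b) =
      ∑ c, F.tr (F.dual c * (F.basis b * a)) • B (F.basis c) (F.dual b) := fun b => by
    conv_lhs => rw [← F.sum_tr_smul_basis (F.basis b * a)]
    simp
  have h₂ : ∀ c, B (F.basis c) (a * F.dual c) =
      ∑ b, F.tr (a * F.dual c * F.basis b) • B (F.basis c) (F.dual b) := fun c => by
    conv_lhs => rw [← F.sum_tr_smul_dual (a * F.dual c)]
    simp
  simp only [h₁, h₂, Finset.smul_sum, smul_smul]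
  rw [Finset.sum_comm]
  refine Finset.sum_congr rfl fun c _ => Finset.sum_congr rfl fun b _ => ?_
  congr 1
  have hm := SetLike.mul_mem_graded (F.dual_mem c) (F.basis_mem b)
  rw [mul_assoc a, ← mul_assoc, F.tr_symm _ _ a ha _ hm, ← mul_assoc]
  by_cases h : F.par c + F.trp + F.par b + p = F.trp
  · have hp : p = F.par b + F.par c := by
      revert h
      generalize F.par b = q; generalize F.par c = r; generalize F.trp = t
      clear ha; revert p q r t; decide
    subst hp
    simp only [sgn_add_left, sgn_add_right, sgn_comm (F.par c) (F.par b), sgn_comm _ F.trp]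
    rcases zmod_two_cases (F.par b) with e₁ | e₁ <;> rcases zmod_two_cases (F.par c) with e₂ | e₂ <;>
      rcases zmod_two_cases F.trp with e₃ | e₃ <;> simp [e₁, e₂, e₃, sgn_one_one]
  · rw [F.tr_mul_eq_zero h hm ha]
    simp

/-- Both sums expand over pairs of basis elements, with coefficients $\mathrm{tr}(c^\vee b^\vee)$
and $\mathrm{tr}(b^\vee c^\vee)$; these vanish unless $\sigma=\bar b+\bar c$, where supersymmetry
gives the sign. -/
theorem sum_dual_basis (B : A →ₗ[k] A →ₗ[k] R) :
    ∑ b, sgn k 1 (F.par b) • B (F.dual b) (F.basis b) =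
      sgn k F.trp 1 • ∑ c, sgn k F.trp (F.par c) • B (F.basis c) (F.dual c) := by
  have h₁ : ∀ b, B (F.dual b) (F.basis b) =
      ∑ c, F.tr (F.dual c * F.dual b) • B (F.basis c) (F.basis b) := fun b => by
    conv_lhs => rw [← F.sum_tr_smul_basis (F.dual b)]
    simp
  have h₂ : ∀ c, B (F.basis c) (F.dual c) =
      ∑ b, F.tr (F.dual b * F.dual c) • B (F.basis c) (F.basis b) := fun c => by
    conv_lhs => rw [← F.sum_tr_smul_basis (F.dual c)]
    simp
  simp only [h₁, h₂, Finset.smul_sum, smul_smul]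
  rw [Finset.sum_comm]
  refine Finset.sum_congr rfl fun c _ => Finset.sum_congr rfl fun b _ => ?_
  congr 1
  rw [F.tr_symm _ _ _ (F.dual_mem b) _ (F.dual_mem c)]
  by_cases h : F.par c + F.trp + (F.par b + F.trp) = F.trp
  · have hp : F.trp = F.par b + F.par c := by
      revert h
      generalize F.par b = q; generalize F.par c = r; generalize F.trp = t; revert q r t; decide
    rw [hp]
    simp only [sgn_add_left, sgn_add_right]
    rcases zmod_two_cases (F.par b) with e₁ | e₁ <;> rcases zmod_two_cases (F.par c) with e₂ | e₂ <;>
      simp [e₁, e₂, sgn_one_one]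
  · rw [F.tr_mul_eq_zero h (F.dual_mem c) (F.dual_mem b)]
    simp

end SymmetricFrobenius

/-! ### Systems of tokens and dots -/

section Systems

variable {k : Type u} [CommRing k] {A : Type v} [Ring A] [Algebra k A]
  {R : Type x} [Ring R] [Algebra k R] {n : ℕ}

/-- Tokens and dots on `n` strands, in an arbitrary algebra. -/
structure IsPolSystem (𝒜 : ZMod 2 → Submodule k A) (t : ZMod 2) (T : Fin n → A →ₐ[k] R)
    (X : Fin n → R) : Prop where
  tok_tok : ∀ {i j : Fin n} {p q : ZMod 2} {a b : A}, i ≠ j → a ∈ 𝒜 p → b ∈ 𝒜 q →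
    T i a * T j b = sgn k p q • (T j b * T i a)
  tok_dot : ∀ (i j : Fin n) {p : ZMod 2} {a : A}, a ∈ 𝒜 p →
    T i a * X j = sgn k t p • (X j * T i a)
  dot_dot : ∀ {i j : Fin n}, i ≠ j → X i * X j = sgn k t t • (X j * X i)

variable {𝒜 : ZMod 2 → Submodule k A} {ι : Type w} [Fintype ι] (F : SymmetricFrobenius k 𝒜 ι)

/-- The teleporter between the strands `i` and `j`. -/
noncomputable def tele (T : Fin n → A →ₐ[k] R) (i j : Fin n) : R :=
  ∑ b, sgn k F.trp (F.par b) • (T i (F.basis b) * T j (F.dual b))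

theorem map_tele {S : Type*} [Ring S] [Algebra k S] (ψ : R →ₐ[k] S) (T : Fin n → A →ₐ[k] R)
    (i j : Fin n) : ψ (tele F T i j) = tele F (fun l => ψ.comp (T l)) i j := by
  simp [tele]

namespace IsPolSystem

variable {F} {T : Fin n → A →ₐ[k] R} {X : Fin n → R}

theorem comp {S : Type*} [Ring S] [Algebra k S] {t : ZMod 2} (h : IsPolSystem 𝒜 t T X)
    (ψ : R →ₐ[k] S) : IsPolSystem 𝒜 t (fun i => ψ.comp (T i)) (fun i => ψ (X i)) where
  tok_tok hij ha hb := by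
    simpa using congrArg ψ (h.tok_tok hij ha hb)
  tok_dot i j p a ha := by
    simpa using congrArg ψ (h.tok_dot i j ha)
  dot_dot hij := by
    simpa using congrArg ψ (h.dot_dot hij)

variable [GradedAlgebra 𝒜] (h : IsPolSystem 𝒜 F.trp T X)
include h

/-- This symmetry absorbs the sign $(-1)^\sigma$ of the second dot-crossing relation, which is why
`IsCrossSystem.dot_right` has the teleporter from `j` to `i` and no sign. -/
theorem tele_swap {i j : Fin n} (hij : i ≠ j) :
    tele F T j i = sgn k F.trp 1 • tele F T i j := by
  have e := F.sum_dual_basis ((LinearMap.mul k R).compl₁₂ (T i).toLinearMap (T j).toLinearMap)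
  simp only [LinearMap.compl₁₂_apply, LinearMap.mul_apply', AlgHom.toLinearMap_apply] at e
  rw [tele, tele, ← e]
  refine Finset.sum_congr rfl fun b _ => ?_
  rw [h.tok_tok hij.symm (F.basis_mem b) (F.dual_mem b), smul_smul]
  congr 1
  rw [sgn_add_right, sgn_comm (F.par b) F.trp, mul_left_comm, sgn_mul_self, mul_one, sgn_self,
    sgn_comm]

/-- A token teleports from one end to the other: this is `sum_basis_mul_dual` for the pairing of the
two strands. -/
theorem tok_mul_tele_right {i j : Fin n} (hij : i ≠ j) {p : ZMod 2} {a : A} (ha : a ∈ 𝒜 p) :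
    T j a * tele F T i j = sgn k F.trp p • (tele F T i j * T i a) := by
  have e := F.sum_basis_mul_dual
    ((LinearMap.mul k R).compl₁₂ (T i).toLinearMap (T j).toLinearMap) ha
  simp only [LinearMap.compl₁₂_apply, LinearMap.mul_apply', AlgHom.toLinearMap_apply] at e
  have e₁ : T j a * tele F T i j =
      ∑ b, sgn k (F.trp + p) (F.par b) • (T i (F.basis b) * T j (a * F.dual b)) := by
    rw [tele, Finset.mul_sum]
    refine Finset.sum_congr rfl fun b _ => ?_
    rw [mul_smul_comm, ← mul_assoc, h.tok_tok hij.symm ha (F.basis_mem b), smul_mul_assoc,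
      smul_smul, mul_assoc, ← map_mul, sgn_add_left]
  have e₂ : sgn k F.trp p • (tele F T i j * T i a) =
      ∑ b, sgn k (F.trp + p) (F.par b) • (T i (F.basis b * a) * T j (F.dual b)) := by
    rw [tele, Finset.sum_mul, Finset.smul_sum]
    refine Finset.sum_congr rfl fun b _ => ?_
    rw [smul_mul_assoc, mul_assoc, h.tok_tok hij.symm (F.dual_mem b) ha, mul_smul_comm,
      ← mul_assoc, ← map_mul, smul_smul, smul_smul]
    congr 1
    rw [sgn_add_left, sgn_add_left, sgn_comm p (F.par b)]
    linear_combination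
      (sgn k F.trp (F.par b) * sgn k (F.par b) p) * sgn_mul_self (k := k) F.trp p
  rw [e₁, e₂, e]

theorem tok_mul_tele_left {i j : Fin n} (hij : i ≠ j) {p : ZMod 2} {a : A} (ha : a ∈ 𝒜 p) :
    T i a * tele F T i j = sgn k F.trp p • (tele F T i j * T j a) := by
  rw [h.tele_swap hij.symm, mul_smul_comm, h.tok_mul_tele_right hij.symm ha, smul_mul_assoc,
    smul_comm]

theorem tok_mul_tele_of_ne {i j l : Fin n} (hi : l ≠ i) (hj : l ≠ j) {p : ZMod 2} {a : A}
    (ha : a ∈ 𝒜 p) : T l a * tele F T i j = sgn k F.trp p • (tele F T i j * T l a) := by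
  rw [tele, Finset.mul_sum, Finset.sum_mul, Finset.smul_sum]
  refine Finset.sum_congr rfl fun b _ => ?_
  rw [mul_smul_comm, ← mul_assoc, h.tok_tok hi ha (F.basis_mem b), smul_mul_assoc, mul_assoc,
    h.tok_tok hj ha (F.dual_mem b), mul_smul_comm, smul_mul_assoc, mul_assoc, smul_smul,
    smul_smul, smul_smul]
  congr 1
  rw [sgn_add_right, sgn_comm F.trp p]
  linear_combination
    (sgn k F.trp (F.par b) * sgn k p F.trp) * sgn_mul_self (k := k) p (F.par b)

theorem tok_swap_mul_tele {i j : Fin n} (hij : i ≠ j) (l : Fin n) {p : ZMod 2} {a : A}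
    (ha : a ∈ 𝒜 p) :
    T (Equiv.swap i j l) a * tele F T i j = sgn k F.trp p • (tele F T i j * T l a) := by
  by_cases hi : l = i
  · subst hi; rw [Equiv.swap_apply_left, h.tok_mul_tele_right hij ha]
  by_cases hj : l = j
  · subst hj; rw [Equiv.swap_apply_right, h.tok_mul_tele_left hij ha]
  rw [Equiv.swap_apply_of_ne_of_ne hi hj, h.tok_mul_tele_of_ne hi hj ha]

theorem tele_mul_dot (i j l : Fin n) :
    tele F T i j * X l = sgn k F.trp F.trp • (X l * tele F T i j) := by
  rw [tele, Finset.mul_sum, Finset.sum_mul, Finset.smul_sum]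
  refine Finset.sum_congr rfl fun b _ => ?_
  rw [smul_mul_assoc, mul_assoc, h.tok_dot j l (F.dual_mem b), mul_smul_comm, ← mul_assoc,
    h.tok_dot i l (F.basis_mem b), smul_mul_assoc, mul_assoc, mul_smul_comm, smul_smul,
    smul_smul, smul_smul]
  congr 1
  rw [sgn_add_right]
  linear_combination
    (sgn k F.trp (F.par b) * sgn k F.trp F.trp) * sgn_mul_self (k := k) F.trp (F.par b)

end IsPolSystem

/-! ### Crossings -/

/-- Crossings that satisfy the nilCoxeter relations. -/
structure IsNilCoxSystem (U : Fin n → R) : Prop where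
  sq : ∀ {i j : Fin n}, (i : ℕ) + 1 = j → U i * U i = 0
  braid : ∀ {i j l : Fin n}, (i : ℕ) + 1 = j → (j : ℕ) + 1 = l →
    U i * U j * U i = U j * U i * U j
  far : ∀ {i i' j j' : Fin n}, (i : ℕ) + 1 = i' → (j : ℕ) + 1 = j' → i' < j →
    U i * U j = U j * U i

/-- Crossings `U i` of the strands `i` and `i + 1` through which tokens slide freely and dots
slide up to teleporters. -/
structure IsCrossSystem (T : Fin n → A →ₐ[k] R) (X U : Fin n → R) : Prop where
  tok : ∀ {i j : Fin n} (l : Fin n) (a : A), (i : ℕ) + 1 = j →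
    U i * T l a = T (Equiv.swap i j l) a * U i
  dot_left : ∀ {i j : Fin n}, (i : ℕ) + 1 = j → U i * X i = X j * U i + tele F T i j
  dot_right : ∀ {i j : Fin n}, (i : ℕ) + 1 = j → U i * X j = X i * U i - tele F T j i
  dot_of_ne : ∀ {i j l : Fin n}, (i : ℕ) + 1 = j → l ≠ i → l ≠ j → U i * X l = X l * U i

namespace IsCrossSystem

variable {F} {T : Fin n → A →ₐ[k] R} {X U : Fin n → R} (h : IsCrossSystem F T X U)
include h

theorem mul_tele {i j : Fin n} (hij : (i : ℕ) + 1 = j) (a b : Fin n) :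
    U i * tele F T a b = tele F T (Equiv.swap i j a) (Equiv.swap i j b) * U i := by
  rw [tele, tele, Finset.mul_sum, Finset.sum_mul]
  refine Finset.sum_congr rfl fun c _ => ?_
  rw [mul_smul_comm, ← mul_assoc, h.tok _ _ hij, mul_assoc, h.tok _ _ hij, smul_mul_assoc,
    mul_assoc]

theorem sq_mul_tok {i j : Fin n} (hij : (i : ℕ) + 1 = j) (l : Fin n) (a : A) :
    U i * U i * T l a = T l a * (U i * U i) := by
  rw [mul_assoc, h.tok _ _ hij, ← mul_assoc, h.tok _ _ hij, Equiv.swap_apply_self, mul_assoc]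

/-- Moving a dot on one of the two strands through both crossings creates two teleporter terms that
cancel. The square need not vanish for this. -/
theorem sq_mul_dot {i j : Fin n} (hij : (i : ℕ) + 1 = j) (l : Fin n) :
    U i * U i * X l = X l * (U i * U i) := by
  by_cases hi : l = i
  · subst hi
    rw [mul_assoc, h.dot_left hij, mul_add, ← mul_assoc, h.dot_right hij, h.mul_tele hij,
      Equiv.swap_apply_left, Equiv.swap_apply_right]
    noncomm_ring
  by_cases hj : l = j
  · subst hj
    rw [mul_assoc, h.dot_right hij, mul_sub, ← mul_assoc, h.dot_left hij, h.mul_tele hij,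
      Equiv.swap_apply_left, Equiv.swap_apply_right]
    noncomm_ring
  rw [mul_assoc, h.dot_of_ne hij hi hj, ← mul_assoc, h.dot_of_ne hij hi hj, mul_assoc]

theorem far_mul_tok {i i' j j' : Fin n} (hi : (i : ℕ) + 1 = i') (hj : (j : ℕ) + 1 = j')
    (hij : i' < j) (l : Fin n) (a : A) : ∃ l', (U i * U j - U j * U i) * T l a =
      T l' a * (U i * U j - U j * U i) := by
  have e : Equiv.swap i i' (Equiv.swap j j' l) = Equiv.swap j j' (Equiv.swap i i' l) := by
    simp only [Equiv.swap_apply_def]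
    grind
  refine ⟨Equiv.swap i i' (Equiv.swap j j' l), ?_⟩
  rw [sub_mul, mul_assoc, h.tok l a hj, ← mul_assoc, h.tok _ a hi, mul_assoc (U j), h.tok l a hi,
    ← mul_assoc (U j), h.tok _ a hj, ← e]
  noncomm_ring

/-- The teleporter created by one crossing lies on strands that the other one does not touch, so it
cancels in the commutator. The disjunction allows the two crossings to exchange roles. -/
theorem far_mul_dot_aux {i i' j j' : Fin n} (hi : (i : ℕ) + 1 = i') (hj : (j : ℕ) + 1 = j')
    (hij : i' < j ∨ j' < i) : (U i * U j - U j * U i) * X i = X i' * (U i * U j - U j * U i) ∧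
      (U i * U j - U j * U i) * X i' = X i * (U i * U j - U j * U i) := by
  have hne : i ≠ j ∧ i ≠ j' ∧ i' ≠ j ∧ i' ≠ j' := by grind
  obtain ⟨h₁, h₂, h₃, h₄⟩ := hne
  have e₁ := h.dot_of_ne hj h₁ h₂
  have e₂ := h.dot_of_ne hj h₃ h₄
  have e₃ := h.mul_tele hj i i'
  have e₄ := h.mul_tele hj i' i
  rw [Equiv.swap_apply_of_ne_of_ne h₁ h₂, Equiv.swap_apply_of_ne_of_ne h₃ h₄] at e₃ e₄
  constructor
  · rw [sub_mul, mul_assoc, e₁, ← mul_assoc, h.dot_left hi, mul_assoc (U j), h.dot_left hi,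
      mul_add (U j), e₃, ← mul_assoc, e₂]
    noncomm_ring
  · rw [sub_mul, mul_assoc, e₂, ← mul_assoc, h.dot_right hi, mul_assoc (U j), h.dot_right hi,
      mul_sub (U j), e₄, ← mul_assoc, e₁]
    noncomm_ring

theorem far_mul_dot {i i' j j' : Fin n} (hi : (i : ℕ) + 1 = i') (hj : (j : ℕ) + 1 = j')
    (hij : i' < j) (l : Fin n) : ∃ l', (U i * U j - U j * U i) * X l =
      X l' * (U i * U j - U j * U i) := by
  have a₁ := h.far_mul_dot_aux hi hj (.inl hij)
  have a₂ := h.far_mul_dot_aux hj hi (.inr hij)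
  rw [← neg_sub (U i * U j), neg_mul, mul_neg, neg_mul, mul_neg, neg_inj, neg_inj] at a₂
  by_cases l₁ : l = i
  · subst l₁; exact ⟨_, a₁.1⟩
  by_cases l₂ : l = i'
  · subst l₂; exact ⟨_, a₁.2⟩
  by_cases l₃ : l = j
  · subst l₃; exact ⟨_, a₂.1⟩
  by_cases l₄ : l = j'
  · subst l₄; exact ⟨_, a₂.2⟩
  refine ⟨l, ?_⟩
  rw [sub_mul, mul_assoc, h.dot_of_ne hj l₃ l₄, ← mul_assoc, h.dot_of_ne hi l₁ l₂,
    mul_assoc (U j), h.dot_of_ne hi l₁ l₂, ← mul_assoc (U j), h.dot_of_ne hj l₃ l₄]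
  noncomm_ring

theorem braid_mul_tok {i j m : Fin n} (hij : (i : ℕ) + 1 = j) (hjm : (j : ℕ) + 1 = m)
    (l : Fin n) (a : A) : ∃ l', (U i * U j * U i - U j * U i * U j) * T l a =
      T l' a * (U i * U j * U i - U j * U i * U j) := by
  have e : Equiv.swap i j (Equiv.swap j m (Equiv.swap i j l)) =
      Equiv.swap j m (Equiv.swap i j (Equiv.swap j m l)) := by
    simp only [Equiv.swap_apply_def]
    grind
  have e₁ : U i * U j * U i * T l a =
      T (Equiv.swap i j (Equiv.swap j m (Equiv.swap i j l))) a * (U i * U j * U i) := by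
    rw [mul_assoc, h.tok l a hij, ← mul_assoc, mul_assoc (U i), h.tok _ a hjm, ← mul_assoc (U i),
      h.tok _ a hij]
    noncomm_ring
  have e₂ : U j * U i * U j * T l a =
      T (Equiv.swap j m (Equiv.swap i j (Equiv.swap j m l))) a * (U j * U i * U j) := by
    rw [mul_assoc, h.tok l a hjm, ← mul_assoc, mul_assoc (U j), h.tok _ a hij, ← mul_assoc (U j),
      h.tok _ a hjm]
    noncomm_ring
  exact ⟨_, by rw [sub_mul, e₁, e₂, ← e, mul_sub]⟩

/-- Dots on the outer strands exchange places and a dot on the middle strand stays. Both sides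
produce the same teleporter terms, apart from terms that contain $u_i^2$ or $u_j^2$; hence the
hypotheses that these squares vanish. -/
theorem braid_mul_dot {i j m : Fin n} (hij : (i : ℕ) + 1 = j) (hjm : (j : ℕ) + 1 = m)
    (hi : U i * U i = 0) (hj : U j * U j = 0) (l : Fin n) :
    ∃ l', (U i * U j * U i - U j * U i * U j) * X l =
      X l' * (U i * U j * U i - U j * U i * U j) := by
  have nij : i ≠ j := by rintro rfl; omega
  have njm : j ≠ m := by rintro rfl; omega
  have nim : i ≠ m := by rintro rfl; omega
  have a₁ := h.dot_left hij
  have a₂ := h.dot_right hij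
  have a₃ := h.dot_of_ne hij nim.symm njm.symm
  have b₁ := h.dot_left hjm
  have b₂ := h.dot_right hjm
  have b₃ := h.dot_of_ne hjm nij nim
  have ti := h.mul_tele hij
  have tj := h.mul_tele hjm
  have s₁ := Equiv.swap_apply_of_ne_of_ne nim.symm njm.symm
  have s₂ := Equiv.swap_apply_of_ne_of_ne nij nim
  have ti₁ := ti i m
  have ti₂ := ti j m
  have ti₃ := ti m i
  have ti₄ := ti m j
  have tj₁ := tj i j
  have tj₂ := tj i m
  have tj₃ := tj j i
  have tj₄ := tj m i
  rw [Equiv.swap_apply_left, s₁] at ti₁ ti₃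
  rw [Equiv.swap_apply_right, s₁] at ti₂ ti₄
  rw [Equiv.swap_apply_left, s₂] at tj₁ tj₃
  rw [Equiv.swap_apply_right, s₂] at tj₂ tj₄
  by_cases l₁ : l = i
  · subst l₁
    refine ⟨m, ?_⟩
    have e₁ : U l * U j * U l * X l = X m * (U l * U j * U l) + tele F T j m * (U l * U j) := by
      calc U l * U j * U l * X l
          = U l * (U j * X j) * U l + U l * (U j * tele F T l j) := by
            rw [mul_assoc, a₁]; noncomm_ring
        _ = (U l * X m) * U j * U l + (U l * tele F T j m) * U l + (U l * tele F T l m) * U j := by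
            rw [b₁, tj₁]; noncomm_ring
        _ = X m * (U l * U j * U l) + tele F T l m * (U l * U l) + tele F T j m * (U l * U j) := by
            rw [a₃, ti₂, ti₁]; noncomm_ring
        _ = _ := by rw [hi, mul_zero, add_zero]
    have e₂ : U j * U l * U j * X l = X m * (U j * U l * U j) + tele F T j m * (U l * U j) := by
      calc U j * U l * U j * X l
          = U j * (U l * X l) * U j := by rw [mul_assoc, b₃]; noncomm_ring
        _ = (U j * X j) * U l * U j + (U j * tele F T l j) * U j := by rw [a₁]; noncomm_ring
        _ = X m * (U j * U l * U j) + tele F T j m * (U l * U j) + tele F T l m * (U j * U j) := by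
            rw [b₁, tj₁]; noncomm_ring
        _ = _ := by rw [hj, mul_zero, add_zero]
    rw [sub_mul, e₁, e₂]
    noncomm_ring
  by_cases l₂ : l = j
  · subst l₂
    refine ⟨l, ?_⟩
    have e₁ : U i * U l * U i * X l = X l * (U i * U l * U i) + tele F T i l * (U l * U i) -
        tele F T m l * (U i * U l) := by
      calc U i * U l * U i * X l
          = U i * (U l * X i) * U i - U i * (U l * tele F T l i) := by
            rw [mul_assoc, a₂]; noncomm_ring
        _ = (U i * X i) * U l * U i - (U i * tele F T m i) * U l := by
            rw [b₃, tj₃]; noncomm_ring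
        _ = _ := by rw [a₁, ti₃]; noncomm_ring
    have e₂ : U l * U i * U l * X l = X l * (U l * U i * U l) + tele F T i l * (U l * U i) -
        tele F T m l * (U i * U l) := by
      calc U l * U i * U l * X l
          = U l * (U i * X m) * U l + U l * (U i * tele F T l m) := by
            rw [mul_assoc, b₁]; noncomm_ring
        _ = (U l * X m) * U i * U l + (U l * tele F T i m) * U i := by
            rw [a₃, ti₂]; noncomm_ring
        _ = _ := by rw [b₂, tj₂]; noncomm_ring
    rw [sub_mul, e₁, e₂]
    noncomm_ring
  by_cases l₃ : l = m
  · subst l₃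
    refine ⟨i, ?_⟩
    have e₁ : U i * U j * U i * X l = X i * (U i * U j * U i) - tele F T j i * (U j * U i) := by
      calc U i * U j * U i * X l
          = U i * (U j * X l) * U i := by rw [mul_assoc, a₃]; noncomm_ring
        _ = (U i * X j) * U j * U i - (U i * tele F T l j) * U i := by rw [b₂]; noncomm_ring
        _ = X i * (U i * U j * U i) - tele F T j i * (U j * U i) - tele F T l i * (U i * U i) := by
            rw [a₂, ti₄]; noncomm_ring
        _ = _ := by rw [hi, mul_zero, sub_zero]
    have e₂ : U j * U i * U j * X l = X i * (U j * U i * U j) - tele F T j i * (U j * U i) := by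
      calc U j * U i * U j * X l
          = U j * (U i * X j) * U j - U j * (U i * tele F T l j) := by
            rw [mul_assoc, b₂]; noncomm_ring
        _ = (U j * X i) * U i * U j - (U j * tele F T j i) * U j - (U j * tele F T l i) * U i := by
            rw [a₂, ti₄]; noncomm_ring
        _ = X i * (U j * U i * U j) - tele F T l i * (U j * U j) - tele F T j i * (U j * U i) := by
            rw [b₃, tj₃, tj₄]; noncomm_ring
        _ = _ := by rw [hj, mul_zero, sub_zero]
    rw [sub_mul, e₁, e₂]
    noncomm_ring
  refine ⟨l, ?_⟩
  have ei := h.dot_of_ne hij l₁ l₂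
  have ej := h.dot_of_ne hjm l₂ l₃
  have e₁ : U i * U j * U i * X l = X l * (U i * U j * U i) := by
    rw [mul_assoc, ei, ← mul_assoc, mul_assoc (U i), ej, ← mul_assoc (U i), ei]
    noncomm_ring
  have e₂ : U j * U i * U j * X l = X l * (U j * U i * U j) := by
    rw [mul_assoc, ej, ← mul_assoc, mul_assoc (U j), ei, ← mul_assoc (U j), ej]
    noncomm_ring
  rw [sub_mul, e₁, e₂, mul_sub]

end IsCrossSystem

end Systems

open Diag Presentation

variable {k : Type u} [CommRing k] {A : Type v} [Ring A] [Algebra k A]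

/-! ### Tokens in endomorphism algebras -/

section Tokens

variable {P : Presentation.{u, w} k} {tok : A → P.Gen 1}

theorem mk_token_add (htok : ∀ n f g, TokenRel (fun a => .gen (tok a)) n f g → P.rel n f g)
    (a b : A) : (EndAlg.mk (gen (tok (a + b))) : P.EndAlg 1) =
      EndAlg.mk (gen (tok a)) + EndAlg.mk (gen (tok b)) := by
  have e := EndAlg.mk_eq (Step.rel (htok _ _ _ (TokenRel.linear 1 1 a b)))
  simpa only [EndAlg.mk_add, EndAlg.mk_smul, one_smul, eq_comm] using e

/-- The tokens on the strand `i`, as an algebra homomorphism. -/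
def tokAt (hP : P.HomogSpanned)
    (htok : ∀ n f g, TokenRel (fun a => .gen (tok a)) n f g → P.rel n f g) {n : ℕ} (i : Fin n) :
    A →ₐ[k] P.EndAlg n :=
  AlgHom.ofLinearMap
    { toFun := fun a => P.genAt n 1 i (tok a)
      map_add' := fun a b => by
        have e := (isModel_genAt hP).rel _ _ _ i (htok _ _ _ (TokenRel.linear 1 1 a b))
          (Nat.succ_le_of_lt i.2)
        simpa [eq_comm] using e
      map_smul' := fun c a => by
        have e := (isModel_genAt hP).rel _ _ _ i (htok _ _ _ (TokenRel.linear c 0 a 0))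
          (Nat.succ_le_of_lt i.2)
        simpa [eq_comm] using e }
    (by
      have e := (isModel_genAt hP).rel _ _ _ i (htok _ _ _ TokenRel.one)
          (Nat.succ_le_of_lt i.2)
      simpa using e)
    (fun a b => by
      have e := (isModel_genAt hP).rel _ _ _ i (htok _ _ _ (TokenRel.mul a b))
          (Nat.succ_le_of_lt i.2)
      simpa [eq_comm] using e)

end Tokens

theorem exists_fin {n j : ℕ} (h : j < n) : ∃ i : Fin n, (i : ℕ) = j := ⟨⟨j, h⟩, rfl⟩

variable {R : Type x} [Ring R] [Algebra k R] {n : ℕ}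

theorem eval_teleporter {G : ℕ → Type v} {𝒜 : ZMod 2 → Submodule k A} {ι : Type w} [Fintype ι]
    (F : SymmetricFrobenius k 𝒜 ι) (tok : A → Diag k G 1) (φ : ∀ m, ℕ → G m → R) (j : ℕ) :
    (teleporter F tok).eval φ j = ∑ b, sgn k F.trp (F.par b) •
      ((tok (F.basis b)).eval φ j * (tok (F.dual b)).eval φ (j + 1)) := by
  rw [teleporter, eval_list_sum, List.map_map, ← Finset.sum_map_toList]
  rfl

/-! ### The Frobenius polynomial algebra -/

section Pol

variable {𝒜 : ZMod 2 → Submodule k A} {t : ZMod 2}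

theorem polCat_tok (n : ℕ) (f g : Diag k (PolGen A) n)
    (h : TokenRel (fun a => .gen (.token a)) n f g) : (polCat 𝒜 t).rel n f g := .inl h

theorem polCat_homogSpanned [GradedAlgebra 𝒜] : (polCat 𝒜 t).HomogSpanned := by
  intro m g
  cases g with
  | token a =>
    obtain ⟨b, hb, c, hc, rfl⟩ := exists_eq_add_mem 𝒜 0 a
    rw [zero_add] at hc
    exact ⟨_, _, .gen (.token 0 b hb), .gen (.token 1 c hc), mk_token_add polCat_tok b c⟩
  | dot =>
    rcases zmod_two_cases t with rfl | rfl
    · exact ⟨_, 0, .gen .dot, .zero 1, (add_zero _).symm⟩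
    · exact ⟨0, _, .zero 0, .gen .dot, (zero_add _).symm⟩

/-- Tokens of the Frobenius polynomial algebra. -/
def polTok [GradedAlgebra 𝒜] (i : Fin n) : A →ₐ[k] (polCat 𝒜 t).EndAlg n :=
  tokAt polCat_homogSpanned polCat_tok i

variable (𝒜 t) in
/-- Dots of the Frobenius polynomial algebra. -/
def polDot (i : Fin n) : (polCat 𝒜 t).EndAlg n :=
  (polCat 𝒜 t).genAt n 1 i .dot

theorem isPolSystem_pol [GradedAlgebra 𝒜] :
    IsPolSystem 𝒜 t (polTok (𝒜 := 𝒜) (t := t) (n := n)) (polDot 𝒜 t) := by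
  have hM := isModel_genAt (n := n) (polCat_homogSpanned (𝒜 := 𝒜) (t := t))
  constructor
  · intro i j p q a b hij ha hb
    rcases lt_or_gt_of_ne hij with h | h
    · have e := hM.comm _ _ p q i j (PolPar.token p a ha) (PolPar.token q b hb) h j.2
      change _ = _ at e
      change (polCat 𝒜 t).genAt n 1 i _ * (polCat 𝒜 t).genAt n 1 j _ =
        _ • ((polCat 𝒜 t).genAt n 1 j _ * (polCat 𝒜 t).genAt n 1 i _)
      rw [e, smul_smul, sgn_mul_self, one_smul]
    · have e := hM.comm _ _ q p j i (PolPar.token q b hb) (PolPar.token p a ha) h i.2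
      rw [sgn_comm]
      exact e
  · intro i j p a ha
    rcases lt_trichotomy i j with h | rfl | h
    · have e := hM.comm _ _ p t i j (PolPar.token p a ha) PolPar.dot h j.2
      change _ = _ at e
      change (polCat 𝒜 t).genAt n 1 i _ * (polCat 𝒜 t).genAt n 1 j _ =
        _ • ((polCat 𝒜 t).genAt n 1 j _ * (polCat 𝒜 t).genAt n 1 i _)
      rw [e, smul_smul, sgn_comm p, sgn_mul_self, one_smul]
    · exact hM.rel _ _ _ i (.inr (.comm p a ha)) i.2
    · exact hM.comm _ _ t p j i PolPar.dot (PolPar.token p a ha) h i.2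
  · intro i j hij
    rcases lt_or_gt_of_ne hij with h | h
    · have e := hM.comm _ _ t t i j PolPar.dot PolPar.dot h j.2
      change _ = _ at e
      change (polCat 𝒜 t).genAt n 1 i _ * (polCat 𝒜 t).genAt n 1 j _ =
        _ • ((polCat 𝒜 t).genAt n 1 j _ * (polCat 𝒜 t).genAt n 1 i _)
      rw [e, smul_smul, sgn_mul_self, one_smul]
    · exact hM.comm _ _ t t j i PolPar.dot PolPar.dot h i.2

theorem pol_mem_subalgebra [GradedAlgebra 𝒜] (S : Subalgebra k ((polCat 𝒜 t).EndAlg n))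
    (htok : ∀ i a, polTok i a ∈ S) (hdot : ∀ i, polDot 𝒜 t i ∈ S)
    (f : (polCat 𝒜 t).EndAlg n) : f ∈ S := by
  refine mem_subalgebra_of_genAt_mem polCat_homogSpanned S (fun m j g h => ?_) f
  cases g with
  | token a => exact htok ⟨j, h⟩ a
  | dot => exact hdot ⟨j, h⟩

/-- Values of tokens and dots at all positions. -/
def polVal (T : Fin n → A →ₐ[k] R) (X : Fin n → R) : ∀ m, ℕ → PolGen A m → R
  | _, j, .token a => if h : j < n then T ⟨j, h⟩ a else 0
  | _, j, .dot => if h : j < n then X ⟨j, h⟩ else 0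

@[simp] theorem polVal_token (T : Fin n → A →ₐ[k] R) (X : Fin n → R) (i : Fin n) (a : A) :
    polVal T X 1 i (.token a) = T i a := dif_pos i.2

@[simp] theorem polVal_dot (T : Fin n → A →ₐ[k] R) (X : Fin n → R) (i : Fin n) :
    polVal T X 1 i .dot = X i := dif_pos i.2

namespace IsPolSystem

variable {T : Fin n → A →ₐ[k] R} {X : Fin n → R}

theorem eval_polVal (h : IsPolSystem 𝒜 t T X) {m : ℕ} {f g : Diag k (PolGen A) m} {j : ℕ}
    (hr : TokenRel (fun a => .gen (.token a)) m f g ∨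
      DotTokenRel 𝒜 t (fun a => .gen (.token a)) (.gen .dot) m f g) (hj : j + m ≤ n) :
    f.eval (polVal T X) j = g.eval (polVal T X) j := by
  rcases hr with hr | hr
  · cases hr <;> obtain ⟨i, rfl⟩ := exists_fin (n := n) (j := j) (by omega) <;> simp
  · cases hr with
    | comm p a ha =>
      obtain ⟨i, rfl⟩ := exists_fin (n := n) (j := j) (by omega)
      simpa using h.tok_dot i i ha

theorem isModel (h : IsPolSystem 𝒜 t T X) : (polCat 𝒜 t).IsModel n (polVal T X) where
  comm {m m'} g g' p q j j' hg hg' hj hj' := by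
    have hm : 1 ≤ m := by cases hg <;> exact le_rfl
    have hm' : 1 ≤ m' := by cases hg' <;> exact le_rfl
    obtain ⟨i, rfl⟩ := exists_fin (n := n) (j := j) (by omega)
    obtain ⟨i', rfl⟩ := exists_fin (n := n) (j := j') (by omega)
    have hne : i' ≠ i := by rintro rfl; omega
    unfold CommUpTo
    cases hg with
    | token p a ha =>
      cases hg' with
      | token q b hb =>
        rw [polVal_token, polVal_token, h.tok_tok hne hb ha, sgn_comm]
      | dot =>
        rw [polVal_token, polVal_dot, h.tok_dot _ _ ha, smul_smul, sgn_comm p, sgn_mul_self,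
          one_smul]
    | dot =>
      cases hg' with
      | token q b hb => rw [polVal_token, polVal_dot, h.tok_dot _ _ hb]
      | dot => rw [polVal_dot, polVal_dot, h.dot_dot hne]
  rel _ _ _ _ hr hj := h.eval_polVal hr hj

/-- The universal property of the Frobenius polynomial algebra. -/
def lift (h : IsPolSystem 𝒜 t T X) : (polCat 𝒜 t).EndAlg n →ₐ[k] R := h.isModel.lift

theorem lift_tok [GradedAlgebra 𝒜] (h : IsPolSystem 𝒜 t T X) (i : Fin n) (a : A) :
    h.lift (polTok i a) = T i a :=
  (h.isModel.lift_genAt i.2 _).trans (polVal_token T X i a)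

theorem lift_dot (h : IsPolSystem 𝒜 t T X) (i : Fin n) : h.lift (polDot 𝒜 t i) = X i :=
  (h.isModel.lift_genAt i.2 _).trans (polVal_dot T X i)

end IsPolSystem

end Pol

/-! ### The nilCoxeter algebra of the ground ring -/

section NilCox

theorem nilCoxCat_tok (n : ℕ) (f g : Diag k (NilCoxGen k) n)
    (h : TokenRel (fun a => .gen (.token a)) n f g) :
    (nilCoxCat (evenGrading k)).rel n f g := .inl h

theorem nilCoxCat_homogSpanned : (nilCoxCat (evenGrading k)).HomogSpanned := by
  intro m g
  cases g with
  | token c =>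
    exact ⟨_, 0, .gen (.token 0 c (by simp [evenGrading])), .zero 1, (add_zero _).symm⟩
  | cross => exact ⟨_, 0, .gen .cross, .zero 1, (add_zero _).symm⟩

variable (k) in
/-- Crossings of the nilCoxeter algebra. -/
def nilCoxCross (i : Fin n) : NilCoxAlg (evenGrading k) n :=
  (nilCoxCat (evenGrading k)).genAt n 2 i .cross

theorem isNilCoxSystem_nilCox : IsNilCoxSystem (nilCoxCross k (n := n)) := by
  have hM := isModel_genAt (n := n) (nilCoxCat_homogSpanned (k := k))
  constructor
  · intro i j hij
    exact hM.rel _ _ _ i (.inr .sq) (by omega)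
  · intro i j l hij hjl
    let V : ℕ → NilCoxAlg (evenGrading k) n := fun m =>
      (nilCoxCat (evenGrading k)).genAt n 2 m .cross
    -- Tensoring with an identity strand evaluates to a factor $1$, and an identity strand on the
    -- left shifts the position by one.
    have e : (V i * 1) * ((1 * V (i + 1)) * (V i * 1)) =
        (1 * V (i + 1)) * ((V i * 1) * (1 * V (i + 1))) :=
      hM.rel _ _ _ i (.inr .braid) (by omega)
    rw [hij, mul_one, one_mul, ← mul_assoc, ← mul_assoc] at e
    exact e
  · intro i i' j j' hi hj h
    have e := hM.comm _ _ 0 0 i j NilCoxPar.cross NilCoxPar.cross (by omega) (by omega)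
    rw [CommUpTo, sgn_zero_left, one_smul] at e
    exact e.symm

theorem nilCox_mem_subalgebra (S : Subalgebra k (NilCoxAlg (evenGrading k) n))
    (hcross : ∀ i j : Fin n, (i : ℕ) + 1 = j → nilCoxCross k i ∈ S)
    (z : NilCoxAlg (evenGrading k) n) : z ∈ S := by
  refine mem_subalgebra_of_genAt_mem nilCoxCat_homogSpanned S (fun m j g h => ?_) z
  cases g with
  | token c =>
    -- Tokens form a $\Bbbk$-algebra homomorphism out of $\Bbbk$ itself, hence are scalars, so
    -- crossings alone generate.
    have e := (tokAt (n := n) nilCoxCat_homogSpanned nilCoxCat_tok ⟨j, h⟩).commutes c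
    rw [show (nilCoxCat (evenGrading k)).genAt n 1 j (.token c) = _ from e]
    exact S.algebraMap_mem c
  | cross => exact hcross ⟨j, by omega⟩ ⟨j + 1, by omega⟩ rfl

end NilCox

/-! ### The Frobenius nilHecke algebra -/

section NilHecke

variable {𝒜 : ZMod 2 → Submodule k A} {ι : Type w} [Fintype ι] (F : SymmetricFrobenius k 𝒜 ι)

theorem nilHeckeCat_tok (n : ℕ) (f g : Diag k (NilHeckeGen A) n)
    (h : TokenRel (fun a => .gen (.token a)) n f g) : (nilHeckeCat F).rel n f g := .inl h

theorem nilHeckeCat_homogSpanned [GradedAlgebra 𝒜] : (nilHeckeCat F).HomogSpanned := by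
  intro m g
  cases g with
  | token a =>
    obtain ⟨b, hb, c, hc, rfl⟩ := exists_eq_add_mem 𝒜 0 a
    rw [zero_add] at hc
    exact ⟨_, _, .gen (.token 0 b hb), .gen (.token 1 c hc), mk_token_add (nilHeckeCat_tok F) b c⟩
  | dot =>
    have hd : Homog (k := k) (nilHeckeCat F).par F.trp (.gen NilHeckeGen.dot) := .gen .dot
    rcases zmod_two_cases F.trp with e | e
    · exact ⟨_, 0, e ▸ hd, .zero 1, (add_zero _).symm⟩
    · exact ⟨0, _, .zero 0, e ▸ hd, (zero_add _).symm⟩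
  | cross => exact ⟨_, 0, .gen .cross, .zero 1, (add_zero _).symm⟩

/-- Tokens of the Frobenius nilHecke algebra. -/
def nilHeckeTok [GradedAlgebra 𝒜] (i : Fin n) : A →ₐ[k] NilHeckeAlg F n :=
  tokAt (nilHeckeCat_homogSpanned F) (nilHeckeCat_tok F) i

/-- Dots of the Frobenius nilHecke algebra. -/
def nilHeckeDot (i : Fin n) : NilHeckeAlg F n := (nilHeckeCat F).genAt n 1 i .dot

/-- Crossings of the Frobenius nilHecke algebra. -/
def nilHeckeCross (i : Fin n) : NilHeckeAlg F n := (nilHeckeCat F).genAt n 2 i .cross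

theorem polToNilHecke_tok [GradedAlgebra 𝒜] (i : Fin n) (a : A) :
    polToNilHecke F n (polTok i a) = nilHeckeTok F i a :=
  EndAlg.map_genAt _ _ i.2 _

theorem polToNilHecke_dot (i : Fin n) :
    polToNilHecke F n (polDot 𝒜 F.trp i) = nilHeckeDot F i :=
  EndAlg.map_genAt _ _ i.2 _

theorem nilCoxToNilHecke_cross [GradedAlgebra 𝒜] {i j : Fin n} (h : (i : ℕ) + 1 = j) :
    nilCoxToNilHecke F n (nilCoxCross k i) = nilHeckeCross F i :=
  EndAlg.map_genAt _ _ (by omega) _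

theorem isCrossSystem_nilHecke [GradedAlgebra 𝒜] :
    IsCrossSystem F (nilHeckeTok F (n := n)) (nilHeckeDot F) (nilHeckeCross F) := by
  have hM := isModel_genAt (n := n) (nilHeckeCat_homogSpanned F)
  let T : ℕ → A → NilHeckeAlg F n := fun m a => (nilHeckeCat F).genAt n 1 m (.token a)
  let X : ℕ → NilHeckeAlg F n := fun m => (nilHeckeCat F).genAt n 1 m .dot
  let U : ℕ → NilHeckeAlg F n := fun m => (nilHeckeCat F).genAt n 2 m .cross
  have htele : ∀ {i j : Fin n}, (i : ℕ) + 1 = j →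
      (teleporter F fun a => .gen (.token a)).eval ((nilHeckeCat F).genAt n) i =
        tele F (nilHeckeTok F) i j := by
    intro i j hij
    refine (eval_teleporter F _ _ _).trans ?_
    rw [hij]
    rfl
  -- The crossing is even, so interchange with a token or dot on another strand carries no sign.
  have hfar : ∀ {i j l : Fin n} (g : NilHeckeGen A 1) (p : ZMod 2),
      NilHeckePar 𝒜 F.trp 1 g p → (i : ℕ) + 1 = j → l ≠ i → l ≠ j →
        nilHeckeCross F i * (nilHeckeCat F).genAt n 1 l g =
          (nilHeckeCat F).genAt n 1 l g * nilHeckeCross F i := by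
    intro i j l g p hg hij hi hj
    rcases lt_or_gt_of_ne hi with h | h
    · have e := hM.comm _ _ p 0 l i hg NilHeckePar.cross h (by omega)
      rwa [CommUpTo, sgn_zero_right, one_smul] at e
    · have hj' : (l : ℕ) ≠ j := fun e => hj (Fin.ext e)
      have hi' : (i : ℕ) < l := h
      have e := hM.comm _ _ 0 p i l NilHeckePar.cross hg (by omega) (by omega)
      rw [CommUpTo, sgn_zero_left, one_smul] at e
      exact e.symm
  have hsys : IsPolSystem 𝒜 F.trp (nilHeckeTok F (n := n)) (nilHeckeDot F) := by
    have e := (isPolSystem_pol (𝒜 := 𝒜) (t := F.trp) (n := n)).comp (polToNilHecke F n)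
    convert e using 1
    · funext i; ext a; exact (polToNilHecke_tok F i a).symm
    · funext i; exact (polToNilHecke_dot F i).symm
  refine ⟨?_, ?_, ?_, fun {i j l} hij hi hj => hfar _ _ NilHeckePar.dot hij hi hj⟩
  · intro i j l a hij
    by_cases hi : l = i
    · subst hi
      have e : U l * (T l a * 1) = (1 * T (l + 1) a) * U l :=
        hM.rel _ _ _ l (.inr (.inl (.slide_left a))) (by omega)
      rw [hij, mul_one, one_mul] at e
      rw [Equiv.swap_apply_left]
      exact e
    by_cases hj : l = j
    · subst hj
      have e : U i * (1 * T (i + 1) a) = (T i a * 1) * U i :=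
        hM.rel _ _ _ i (.inr (.inl (.slide_right a))) (by omega)
      rw [hij, mul_one, one_mul] at e
      rw [Equiv.swap_apply_right]
      exact e
    rw [Equiv.swap_apply_of_ne_of_ne hi hj]
    -- Away from the crossing, sliding comes from interchange, which needs homogeneous tokens.
    obtain ⟨b, hb, c, hc, rfl⟩ := exists_eq_add_mem 𝒜 0 a
    rw [map_add, mul_add, add_mul]
    exact congrArg₂ (· + ·) (hfar _ _ (NilHeckePar.token 0 b hb) hij hi hj)
      (hfar _ _ (NilHeckePar.token _ c hc) hij hi hj)
  · intro i j hij
    have e : U i * (X i * 1) + (-1 : k) • ((1 * X (i + 1)) * U i) = tele F (nilHeckeTok F) i j :=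
      (hM.rel _ _ _ i (.inr (.inr (.inr .left))) (by omega)).trans (htele hij)
    rw [hij, mul_one, one_mul, neg_one_smul, ← sub_eq_add_neg, sub_eq_iff_eq_add, add_comm] at e
    exact e
  · intro i j hij
    have e : (X i * 1) * U i + (-1 : k) • (U i * (1 * X (i + 1))) =
        sgn k F.trp 1 • tele F (nilHeckeTok F) i j :=
      (hM.rel _ _ _ i (.inr (.inr (.inr .right))) (by omega)).trans
        (congrArg (sgn k F.trp 1 • ·) (htele hij))
    have hne : i ≠ j := by rintro rfl; omega
    rw [hij, mul_one, one_mul, neg_one_smul, ← hsys.tele_swap hne] at e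
    rw [← e]
    change U i * X j = X i * U i - (X i * U i + -(U i * X j))
    abel

theorem nilHecke_mem_subalgebra [GradedAlgebra 𝒜] (S : Subalgebra k (NilHeckeAlg F n))
    (htok : ∀ i a, nilHeckeTok F i a ∈ S) (hdot : ∀ i, nilHeckeDot F i ∈ S)
    (hcross : ∀ i j : Fin n, (i : ℕ) + 1 = j → nilHeckeCross F i ∈ S)
    (f : NilHeckeAlg F n) : f ∈ S := by
  refine mem_subalgebra_of_genAt_mem (nilHeckeCat_homogSpanned F) S (fun m j g h => ?_) f
  cases g with
  | token a => exact htok ⟨j, h⟩ a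
  | dot => exact hdot ⟨j, h⟩
  | cross => exact hcross ⟨j, by omega⟩ ⟨j + 1, by omega⟩ rfl

/-- Values of tokens, dots and crossings at all positions. -/
def nilHeckeVal (T : Fin n → A →ₐ[k] R) (X U : Fin n → R) : ∀ m, ℕ → NilHeckeGen A m → R
  | _, j, .token a => if h : j < n then T ⟨j, h⟩ a else 0
  | _, j, .dot => if h : j < n then X ⟨j, h⟩ else 0
  | _, j, .cross => if h : j < n then U ⟨j, h⟩ else 0

section Values

variable (T : Fin n → A →ₐ[k] R) (X U : Fin n → R) (i : Fin n)

@[simp] theorem nilHeckeVal_token (a : A) : nilHeckeVal T X U 1 i (.token a) = T i a :=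
  dif_pos i.2

@[simp] theorem nilHeckeVal_dot : nilHeckeVal T X U 1 i .dot = X i := dif_pos i.2

@[simp] theorem nilHeckeVal_cross : nilHeckeVal T X U 2 i .cross = U i := dif_pos i.2

end Values

variable {F} {T : Fin n → A →ₐ[k] R} {X U : Fin n → R}

theorem eval_nilHeckeVal [GradedAlgebra 𝒜] (hP : IsPolSystem 𝒜 F.trp T X)
    (hC : IsCrossSystem F T X U) (hN : IsNilCoxSystem U) {m : ℕ}
    {f g : Diag k (NilHeckeGen A) m} {j : ℕ}
    (hr : TokenRel (fun a => .gen (.token a)) m f g ∨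
      CrossRel (fun a : A => .gen (.token a)) (.gen .cross) m f g ∨
      DotTokenRel 𝒜 F.trp (fun a => .gen (.token a)) (.gen .dot) m f g ∨
      DotCrossRel F (fun a => .gen (.token a)) (.gen .dot) (.gen .cross) m f g)
    (hj : j + m ≤ n) :
    f.eval (nilHeckeVal T X U) j = g.eval (nilHeckeVal T X U) j := by
  rcases hr with hr | hr | hr | hr
  · cases hr <;> obtain ⟨i, rfl⟩ := exists_fin (n := n) (j := j) (by omega) <;> simp
  · obtain ⟨i, rfl⟩ := exists_fin (n := n) (j := j) (by cases hr <;> omega)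
    obtain ⟨l, hl⟩ := exists_fin (n := n) (j := i + 1) (by cases hr <;> omega)
    cases hr with
    | sq => simpa using hN.sq hl.symm
    | braid =>
      obtain ⟨l', hl'⟩ := exists_fin (n := n) (j := l + 1) (by omega)
      simpa [← hl, mul_assoc] using hN.braid hl.symm hl'.symm
    | slide_left a => simpa [← hl] using hC.tok i a hl.symm
    | slide_right a => simpa [← hl] using hC.tok l a hl.symm
  · cases hr with
    | comm p a ha =>
      obtain ⟨i, rfl⟩ := exists_fin (n := n) (j := j) (by omega)
      simpa using hP.tok_dot i i ha
  · obtain ⟨i, rfl⟩ := exists_fin (n := n) (j := j) (by cases hr <;> omega)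
    obtain ⟨l, hl⟩ := exists_fin (n := n) (j := i + 1) (by cases hr <;> omega)
    have ht : (teleporter F fun a => .gen (.token a)).eval (nilHeckeVal T X U) i =
        tele F T i l := by
      rw [eval_teleporter]
      simp [← hl, tele]
    have hne : i ≠ l := by rintro rfl; omega
    cases hr with
    | left =>
      rw [ht]
      simp [← hl, hC.dot_left hl.symm]
    | right =>
      rw [eval_smul, ht, ← hP.tele_swap hne]
      simp [← hl, hC.dot_right hl.symm]

/-- This is the universal property of $\mathrm{NH}_n(A)$: tokens, dots and crossings with the three
kinds of relations define a homomorphism out of it. -/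
theorem isModel_nilHeckeVal [GradedAlgebra 𝒜] (hP : IsPolSystem 𝒜 F.trp T X)
    (hC : IsCrossSystem F T X U) (hN : IsNilCoxSystem U) :
    (nilHeckeCat F).IsModel n (nilHeckeVal T X U) where
  comm {m m'} g g' p q j j' hg hg' hj hj' := by
    have hm : 1 ≤ m := by cases hg <;> omega
    have hm' : 1 ≤ m' := by cases hg' <;> omega
    obtain ⟨i, rfl⟩ := exists_fin (n := n) (j := j) (by omega)
    obtain ⟨i', rfl⟩ := exists_fin (n := n) (j := j') (by omega)
    have hne : i' ≠ i := by rintro rfl; omega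
    unfold CommUpTo
    cases hg with
    | token p a ha =>
      cases hg' with
      | token q b hb =>
        rw [nilHeckeVal_token, nilHeckeVal_token, hP.tok_tok hne hb ha, sgn_comm]
      | dot =>
        rw [nilHeckeVal_token, nilHeckeVal_dot, hP.tok_dot _ _ ha, smul_smul, sgn_comm p,
          sgn_mul_self, one_smul]
      | cross =>
        obtain ⟨l, hl⟩ := exists_fin (n := n) (j := i' + 1) (by omega)
        rw [nilHeckeVal_token, nilHeckeVal_cross, hC.tok i a hl.symm,
          Equiv.swap_apply_of_ne_of_ne hne.symm (by rintro rfl; omega), sgn_zero_right, one_smul]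
    | dot =>
      cases hg' with
      | token q b hb => rw [nilHeckeVal_token, nilHeckeVal_dot, hP.tok_dot _ _ hb]
      | dot => rw [nilHeckeVal_dot, nilHeckeVal_dot, hP.dot_dot hne]
      | cross =>
        obtain ⟨l, hl⟩ := exists_fin (n := n) (j := i' + 1) (by omega)
        rw [nilHeckeVal_dot, nilHeckeVal_cross, hC.dot_of_ne hl.symm hne.symm (by rintro rfl; omega),
          sgn_zero_right, one_smul]
    | cross =>
      obtain ⟨l, hl⟩ := exists_fin (n := n) (j := i + 1) (by omega)
      cases hg' with
      | token q b hb =>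
        rw [nilHeckeVal_token, nilHeckeVal_cross, hC.tok i' b hl.symm,
          Equiv.swap_apply_of_ne_of_ne hne (by rintro rfl; omega), sgn_zero_left, one_smul]
      | dot =>
        rw [nilHeckeVal_dot, nilHeckeVal_cross, hC.dot_of_ne hl.symm hne (by rintro rfl; omega),
          sgn_zero_left, one_smul]
      | cross =>
        obtain ⟨l', hl'⟩ := exists_fin (n := n) (j := i' + 1) (by omega)
        rw [nilHeckeVal_cross, nilHeckeVal_cross, sgn_zero_left, one_smul,
          hN.far hl.symm hl'.symm (Fin.lt_def.2 (by omega))]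
  rel _ _ _ _ hr hj := eval_nilHeckeVal hP hC hN hr hj

end NilHecke

variable {k : Type u} [CommRing k] {A : Type v} [Ring A] [Algebra k A]
  {𝒜 : ZMod 2 → Submodule k A} [GradedAlgebra 𝒜] {ι : Type w} [Fintype ι]
  (F : SymmetricFrobenius k 𝒜 ι) {n : ℕ}

/-! ### Permutation and Demazure operators on the Frobenius polynomial algebra -/

section Demazure

/-- The value of the Demazure operator of the strands `i` and `j` on the dot on the strand `l`. -/
noncomputable def demazureDot (i j l : Fin n) : PolAlg F n :=
  if l = i then tele F polTok i j else if l = j then -tele F polTok j i else 0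

theorem demazureDot_left (i j : Fin n) : demazureDot F i j i = tele F polTok i j := if_pos rfl

theorem demazureDot_right {i j : Fin n} (h : i ≠ j) :
    demazureDot F i j j = -tele F polTok j i := by
  rw [demazureDot, if_neg h.symm, if_pos rfl]

theorem demazureDot_of_ne {i j l : Fin n} (hi : l ≠ i) (hj : l ≠ j) : demazureDot F i j l = 0 := by
  rw [demazureDot, if_neg hi, if_neg hj]

/-- By the symmetry of the teleporter, all values on dots are multiples of a single one, whose
commutation rules then suffice. -/
theorem exists_demazureDot_eq_smul {i j : Fin n} (h : i ≠ j) (l : Fin n) :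
    ∃ c : k, demazureDot F i j l = c • tele F polTok i j := by
  by_cases hi : l = i
  · subst hi; exact ⟨1, by rw [demazureDot_left, one_smul]⟩
  by_cases hj : l = j
  · subst hj
    exact ⟨-sgn k F.trp 1, by rw [demazureDot_right F h, isPolSystem_pol.tele_swap h, neg_smul]⟩
  exact ⟨0, by rw [demazureDot_of_ne F hi hj, zero_smul]⟩

theorem tok_swap_mul_demazureDot {i j : Fin n} (h : i ≠ j) (l m : Fin n) {p : ZMod 2} {a : A}
    (ha : a ∈ 𝒜 p) : polTok (Equiv.swap i j l) a * demazureDot F i j m =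
      sgn k F.trp p • (demazureDot F i j m * polTok l a) := by
  obtain ⟨c, hc⟩ := exists_demazureDot_eq_smul F h m
  rw [hc, mul_smul_comm, isPolSystem_pol.tok_swap_mul_tele h l ha, smul_mul_assoc, smul_comm]

theorem demazureDot_mul_dot {i j : Fin n} (h : i ≠ j) (l m : Fin n) :
    demazureDot F i j l * polDot 𝒜 F.trp m =
      sgn k F.trp F.trp • (polDot 𝒜 F.trp m * demazureDot F i j l) := by
  obtain ⟨c, hc⟩ := exists_demazureDot_eq_smul F h l
  rw [hc, smul_mul_assoc, isPolSystem_pol.tele_mul_dot, mul_smul_comm, smul_comm]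

/-- By the twisted Leibniz rule this says that the Demazure operator respects the supercommutation
of dots; it is the upper right entry in the matrix check below. If both dots lie on the two strands,
each side vanishes; otherwise the terms match in pairs. -/
theorem demazureDot_dot {i j : Fin n} (h : i ≠ j) {l m : Fin n} (hlm : l ≠ m) :
    polDot 𝒜 F.trp (Equiv.swap i j l) * demazureDot F i j m +
        demazureDot F i j l * polDot 𝒜 F.trp m =
      sgn k F.trp F.trp • (polDot 𝒜 F.trp (Equiv.swap i j m) * demazureDot F i j l +
        demazureDot F i j m * polDot 𝒜 F.trp l) := by
  have hd : demazureDot F i j j = -(sgn k F.trp F.trp • demazureDot F i j i) := by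
    rw [demazureDot_right F h, isPolSystem_pol.tele_swap h, demazureDot_left, sgn_self F.trp]
  have e₁ : polDot 𝒜 F.trp j * demazureDot F i j j + demazureDot F i j i * polDot 𝒜 F.trp j = 0 := by
    rw [demazureDot_mul_dot F h, hd, mul_neg, mul_smul_comm, neg_add_cancel]
  have e₂ : polDot 𝒜 F.trp i * demazureDot F i j i + demazureDot F i j j * polDot 𝒜 F.trp i = 0 := by
    rw [demazureDot_mul_dot F h, hd, mul_neg, mul_smul_comm, smul_neg, smul_smul, sgn_mul_self,
      one_smul, add_neg_cancel]
  have key : ∀ {l m : Fin n}, l ≠ i → l ≠ j →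
      polDot 𝒜 F.trp (Equiv.swap i j l) * demazureDot F i j m =
        sgn k F.trp F.trp • (demazureDot F i j m * polDot 𝒜 F.trp l) ∧
      demazureDot F i j l * polDot 𝒜 F.trp m =
        sgn k F.trp F.trp • (polDot 𝒜 F.trp (Equiv.swap i j m) * demazureDot F i j l) := by
    intro l m hi hj
    rw [Equiv.swap_apply_of_ne_of_ne hi hj, demazureDot_mul_dot F h m, smul_smul, sgn_mul_self,
      one_smul, demazureDot_of_ne F hi hj]
    simp
  by_cases hl : l ≠ i ∧ l ≠ j
  · rw [(key hl.1 hl.2).1, (key hl.1 hl.2).2, smul_add, add_comm]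
  by_cases hm : m ≠ i ∧ m ≠ j
  · rw [smul_add, (key hm.1 hm.2).1, (key hm.1 hm.2).2, smul_smul, smul_smul, sgn_mul_self,
      one_smul, one_smul, add_comm]
  have hl' : l = i ∨ l = j := by tauto
  have hm' : m = i ∨ m = j := by tauto
  rcases hl' with rfl | rfl <;> rcases hm' with rfl | rfl
  · exact absurd rfl hlm
  · rw [Equiv.swap_apply_left, Equiv.swap_apply_right, e₁, e₂, smul_zero]
  · rw [Equiv.swap_apply_left, Equiv.swap_apply_right, e₁, e₂, smul_zero]
  · exact absurd rfl hlm

/-- Tokens as diagonal matrices whose first entry is permuted. -/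
noncomputable def matTok (i j l : Fin n) : A →ₐ[k] Matrix (Fin 2) (Fin 2) (PolAlg F n) :=
  (Matrix.diagonalAlgHom k).comp
    (AlgHom.pi ![polTok (Equiv.swap i j l), polTok l])

omit [Fintype ι] in
theorem matTok_apply (i j l : Fin n) (a : A) :
    matTok F i j l a = !![polTok (Equiv.swap i j l) a, 0; 0, polTok l a] := by
  ext p q
  fin_cases p <;> fin_cases q <;> simp [matTok]

/-- Dots as triangular matrices whose first entry is permuted. -/
noncomputable def matDot (i j l : Fin n) : Matrix (Fin 2) (Fin 2) (PolAlg F n) :=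
  !![polDot 𝒜 F.trp (Equiv.swap i j l), demazureDot F i j l; 0, polDot 𝒜 F.trp l]

/-- Multiplicativity of an upper triangular matrix with diagonal $(s(f),f)$ and corner $\partial(f)$
is the multiplicativity of $s$ together with the twisted Leibniz rule. Checking relations on
matrices therefore constructs both operators at once. -/
theorem isPolSystem_mat {i j : Fin n} (h : i ≠ j) :
    IsPolSystem 𝒜 F.trp (matTok F i j) (matDot F i j) := by
  have hs := isPolSystem_pol (𝒜 := 𝒜) (t := F.trp) (n := n)
  constructor
  · intro l m p q a b hlm ha hb
    have hlm' : Equiv.swap i j l ≠ Equiv.swap i j m := (Equiv.injective _).ne hlm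
    simp [matTok_apply, Matrix.smul_of, hs.tok_tok hlm ha hb,
      hs.tok_tok hlm' ha hb]
  · intro l m p a ha
    simp [matTok_apply, matDot, Matrix.smul_of, hs.tok_dot _ _ ha,
      tok_swap_mul_demazureDot F h _ _ ha]
  · intro l m hlm
    have hlm' : Equiv.swap i j l ≠ Equiv.swap i j m := (Equiv.injective _).ne hlm
    simp only [matDot, Matrix.mul_fin_two, demazureDot_dot F h hlm, hs.dot_dot hlm,
      hs.dot_dot hlm', Matrix.smul_of]
    simp

/-- The permutation operator and the Demazure operator of the strands `i` and `j`, assembled into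
triangular matrices. -/
noncomputable def polMat {i j : Fin n} (h : i ≠ j) :
    PolAlg F n →ₐ[k] Matrix (Fin 2) (Fin 2) (PolAlg F n) :=
  (isPolSystem_mat F h).lift

/-- The superpermutation of the strands `i` and `j`. -/
noncomputable def polPerm {i j : Fin n} (h : i ≠ j) : PolAlg F n →ₗ[k] PolAlg F n :=
  Matrix.entryLinearMap k _ 0 0 ∘ₗ (polMat F h).toLinearMap

/-- The Demazure operator of the strands `i` and `j`. -/
noncomputable def demazure {i j : Fin n} (h : i ≠ j) : PolAlg F n →ₗ[k] PolAlg F n :=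
  Matrix.entryLinearMap k _ 0 1 ∘ₗ (polMat F h).toLinearMap

variable {i j : Fin n} (h : i ≠ j)

theorem polMat_apply (f : PolAlg F n) :
    polMat F h f = !![polPerm F h f, demazure F h f; 0, f] := by
  let S : Subalgebra k (PolAlg F n) :=
    { carrier := {f | polMat F h f 1 0 = 0 ∧ polMat F h f 1 1 = f}
      mul_mem' := fun {f g} hf hg => by
        constructor <;> simp [Matrix.mul_apply, hf.1, hf.2, hg.1, hg.2]
      add_mem' := fun {f g} hf hg => by
        constructor <;> simp [hf.1, hf.2, hg.1, hg.2]
      algebraMap_mem' := fun c => by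
        constructor <;> simp [Matrix.algebraMap_matrix_apply] }
  -- The lower row is $(0,f)$ on generators, and upper triangular products preserve this shape.
  have hS : f ∈ S := by
    refine pol_mem_subalgebra S (fun l a => ?_) (fun l => ?_) f
    · change _ ∧ _
      rw [polMat, (isPolSystem_mat F h).lift_tok, matTok_apply]
      simp
    · change _ ∧ _
      rw [polMat, (isPolSystem_mat F h).lift_dot, matDot]
      simp
  ext p q
  fin_cases p <;> fin_cases q
  · rfl
  · rfl
  · exact hS.1
  · exact hS.2

theorem polPerm_one : polPerm F h 1 = 1 := by
  simp [polPerm]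

theorem demazure_one : demazure F h 1 = 0 := by
  simp [demazure]

theorem polPerm_mul (f g : PolAlg F n) :
    polPerm F h (f * g) = polPerm F h f * polPerm F h g := by
  have e := congrFun (congrFun (map_mul (polMat F h) f g) 0) 0
  simpa [polMat_apply, Matrix.mul_fin_two] using e

theorem demazure_mul (f g : PolAlg F n) :
    demazure F h (f * g) = polPerm F h f * demazure F h g + demazure F h f * g := by
  have e := congrFun (congrFun (map_mul (polMat F h) f g) 0) 1
  simpa [polMat_apply, Matrix.mul_fin_two] using e

theorem polPerm_tok (l : Fin n) (a : A) :
    polPerm F h (polTok l a) = polTok (Equiv.swap i j l) a := by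
  have e := congrFun (congrFun ((isPolSystem_mat F h).lift_tok l a) 0) 0
  rw [matTok_apply] at e
  exact e

theorem demazure_tok (l : Fin n) (a : A) : demazure F h (polTok l a) = 0 := by
  have e := congrFun (congrFun ((isPolSystem_mat F h).lift_tok l a) 0) 1
  rw [matTok_apply] at e
  exact e

theorem polPerm_dot (l : Fin n) :
    polPerm F h (polDot 𝒜 F.trp l) = polDot 𝒜 F.trp (Equiv.swap i j l) :=
  congrFun (congrFun ((isPolSystem_mat F h).lift_dot l) 0) 0

theorem demazure_dot (l : Fin n) : demazure F h (polDot 𝒜 F.trp l) = demazureDot F i j l :=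
  congrFun (congrFun ((isPolSystem_mat F h).lift_dot l) 0) 1

end Demazure

theorem ne_of_succ_eq {i j : Fin n} (h : (i : ℕ) + 1 = j) : i ≠ j := by
  rintro rfl
  omega

variable {F} in
/-- A crossing moves past a polynomial through the permutation and Demazure operators. -/
theorem IsCrossSystem.mul_map {R : Type x} [Ring R] [Algebra k R] (ψ : PolAlg F n →ₐ[k] R)
    {U : Fin n → R}
    (hU : IsCrossSystem F (fun l => ψ.comp (polTok l)) (fun l => ψ (polDot 𝒜 F.trp l)) U)
    {i j : Fin n} (hij : (i : ℕ) + 1 = j) (f : PolAlg F n) :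
    U i * ψ f = ψ (polPerm F (ne_of_succ_eq hij) f) * U i + ψ (demazure F (ne_of_succ_eq hij) f) := by
  let S : Subalgebra k (PolAlg F n) :=
    { carrier := {f | U i * ψ f = ψ (polPerm F (ne_of_succ_eq hij) f) * U i +
        ψ (demazure F (ne_of_succ_eq hij) f)}
      mul_mem' := fun {f g} hf hg => by
        change _ = _ at hf hg
        change _ = _
        rw [polPerm_mul, demazure_mul, map_mul, ← mul_assoc, hf, add_mul, mul_assoc, hg]
        simp only [map_mul, map_add, mul_add, mul_assoc, add_assoc]
      add_mem' := fun {f g} hf hg => by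
        change _ = _ at hf hg
        change _ = _
        simp only [map_add, mul_add, add_mul, hf, hg]
        abel
      algebraMap_mem' := fun c => by
        change _ = _
        simp [Algebra.algebraMap_eq_smul_one, polPerm_one, demazure_one] }
  refine pol_mem_subalgebra S (fun l a => ?_) (fun l => ?_) f
  · change _ = _
    rw [polPerm_tok, demazure_tok, map_zero, add_zero]
    exact hU.tok l a hij
  · change _ = _
    rw [polPerm_dot, demazure_dot]
    by_cases hi : l = i
    · subst hi
      rw [Equiv.swap_apply_left, demazureDot_left, map_tele]
      exact hU.dot_left hij
    by_cases hj : l = j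
    · subst hj
      rw [Equiv.swap_apply_right, demazureDot_right F (ne_of_succ_eq hij), map_neg, map_tele,
        ← sub_eq_add_neg]
      exact hU.dot_right hij
    rw [Equiv.swap_apply_of_ne_of_ne hi hj, demazureDot_of_ne F hi hj, map_zero, add_zero]
    exact hU.dot_of_ne hij hi hj

/-! ### The action of the Frobenius nilHecke algebra on the tensor product -/

section Action

/-- The tensor product of the Frobenius polynomial algebra and the nilCoxeter algebra. -/
abbrev PolNilCox (n : ℕ) : Type _ := PolAlg F n ⊗[k] NilCoxAlg (evenGrading k) n

/-- Polynomials act by left multiplication on the first factor. -/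
noncomputable def polAct (n : ℕ) : PolAlg F n →ₐ[k] Module.End k (PolNilCox F n) :=
  (Module.End.rTensorAlgHom k (PolAlg F n) (NilCoxAlg (evenGrading k) n)).comp
    (Algebra.lmul k (PolAlg F n))

omit [GradedAlgebra 𝒜] [Fintype ι] in
theorem polAct_tmul (f g : PolAlg F n) (z : NilCoxAlg (evenGrading k) n) :
    polAct F n f (g ⊗ₜ z) = (f * g) ⊗ₜ z := rfl

/-- The action of crossings. -/
noncomputable def crossAct (i : Fin n) : Module.End k (PolNilCox F n) :=
  if h : (i : ℕ) + 1 < n then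
    have hij : i ≠ ⟨i + 1, h⟩ := ne_of_succ_eq rfl
    -- This formula is dictated by $u_ifz=s_i(f)u_iz+\partial_i(f)z$ in $\mathrm{NH}_n(A)$.
    TensorProduct.map (polPerm F hij) (LinearMap.mulLeft k (nilCoxCross k i)) +
      TensorProduct.map (demazure F hij) LinearMap.id
  else 0

theorem crossAct_tmul {i j : Fin n} (hij : (i : ℕ) + 1 = j) (f : PolAlg F n)
    (z : NilCoxAlg (evenGrading k) n) : crossAct F i (f ⊗ₜ z) =
      polPerm F (ne_of_succ_eq hij) f ⊗ₜ (nilCoxCross k i * z) +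
        demazure F (ne_of_succ_eq hij) f ⊗ₜ z := by
  have hi : (i : ℕ) + 1 < n := hij ▸ j.2
  obtain rfl : j = ⟨i + 1, hi⟩ := Fin.ext hij.symm
  rw [crossAct, dif_pos hi]
  rfl

theorem crossAct_one_tmul {i j : Fin n} (hij : (i : ℕ) + 1 = j)
    (z : NilCoxAlg (evenGrading k) n) :
    crossAct F i (1 ⊗ₜ z) = 1 ⊗ₜ (nilCoxCross k i * z) := by
  rw [crossAct_tmul F hij, polPerm_one, demazure_one, TensorProduct.zero_tmul, add_zero]

/-- The twisted Leibniz rule, read as an identity of operators. Its cases for tokens and dots are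
the required sliding relations. -/
theorem crossAct_mul_polAct {i j : Fin n} (hij : (i : ℕ) + 1 = j) (f : PolAlg F n) :
    crossAct F i * polAct F n f = polAct F n (polPerm F (ne_of_succ_eq hij) f) * crossAct F i +
      polAct F n (demazure F (ne_of_succ_eq hij) f) := by
  refine TensorProduct.ext' fun g z => ?_
  simp only [Module.End.mul_apply, LinearMap.add_apply, polAct_tmul, crossAct_tmul F hij,
    polPerm_mul, demazure_mul, map_add, TensorProduct.add_tmul, add_assoc]

omit [Fintype ι] in
theorem isPolSystem_polAct : IsPolSystem 𝒜 F.trp (fun l => (polAct F n).comp (polTok l))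
    (fun l => polAct F n (polDot 𝒜 F.trp l)) :=
  isPolSystem_pol.comp (S := Module.End k (PolNilCox F n)) (polAct F n)

theorem isCrossSystem_crossAct : IsCrossSystem F (fun l => (polAct F n).comp (polTok l))
    (fun l => polAct F n (polDot 𝒜 F.trp l)) (crossAct F) where
  tok l a hij := by
    have e := crossAct_mul_polAct F hij (polTok l a)
    rwa [polPerm_tok, demazure_tok, map_zero, add_zero] at e
  dot_left {i j} hij := by
    have e := crossAct_mul_polAct F hij (polDot 𝒜 F.trp i)
    rwa [polPerm_dot, demazure_dot, Equiv.swap_apply_left, demazureDot_left,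
      map_tele (S := Module.End k (PolNilCox F n))] at e
  dot_right {i j} hij := by
    have e := crossAct_mul_polAct F hij (polDot 𝒜 F.trp j)
    rwa [polPerm_dot, demazure_dot, Equiv.swap_apply_right,
      demazureDot_right F (ne_of_succ_eq hij), map_neg,
      map_tele (S := Module.End k (PolNilCox F n)), ← sub_eq_add_neg] at e
  dot_of_ne {i j l} hij hi hj := by
    have e := crossAct_mul_polAct F hij (polDot 𝒜 F.trp l)
    rwa [polPerm_dot, demazure_dot, Equiv.swap_apply_of_ne_of_ne hi hj,
      demazureDot_of_ne F hi hj, map_zero, add_zero] at e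

omit [Fintype ι] in
/-- An operator that commutes with the polynomial generators up to permutation vanishes as soon as
it vanishes on the nilCoxeter factor. -/
theorem eq_zero_of_mul_polAct (D : Module.End k (PolNilCox F n))
    (htok : ∀ l a, ∃ l', D * polAct F n (polTok l a) = polAct F n (polTok l' a) * D)
    (hdot : ∀ l, ∃ l', D * polAct F n (polDot 𝒜 F.trp l) = polAct F n (polDot 𝒜 F.trp l') * D)
    (hone : ∀ z, D (1 ⊗ₜ z) = 0) : D = 0 := by
  let S : Subalgebra k (PolAlg F n) :=
    { carrier := {f | ∃ f', D * polAct F n f = polAct F n f' * D}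
      mul_mem' := by
        rintro f g ⟨f', hf⟩ ⟨g', hg⟩
        exact ⟨f' * g', by rw [map_mul, map_mul, ← mul_assoc, hf, mul_assoc, hg, mul_assoc]⟩
      add_mem' := by
        rintro f g ⟨f', hf⟩ ⟨g', hg⟩
        exact ⟨f' + g', by rw [map_add, map_add, mul_add, hf, hg, add_mul]⟩
      algebraMap_mem' := fun c => ⟨algebraMap k _ c, by
        rw [AlgHom.commutes, Algebra.commutes]⟩ }
  refine TensorProduct.ext' fun f z => ?_
  obtain ⟨f', hf⟩ : f ∈ S := pol_mem_subalgebra S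
    (fun l a => (htok l a).imp' (polTok · a) fun _ => id)
    (fun l => (hdot l).imp' (polDot 𝒜 F.trp) fun _ => id) f
  -- Since $f\otimes z$ is $f$ acting on $1\otimes z$, moving $D$ past $f$ leaves $D(1\otimes z)=0$.
  have e := LinearMap.congr_fun hf (1 ⊗ₜ z)
  rw [Module.End.mul_apply, Module.End.mul_apply, polAct_tmul, mul_one, hone, map_zero] at e
  exact e

/-- On vectors $1\otimes z$ the crossings act by left multiplication in $\mathrm{NC}_n(\Bbbk)$,
where the relations hold; `eq_zero_of_mul_polAct` carries them to the whole space. Squares come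
first because the braid case uses them. -/
theorem isNilCoxSystem_crossAct : IsNilCoxSystem (crossAct F (n := n)) := by
  have hC := isCrossSystem_crossAct F (n := n)
  have hN := isNilCoxSystem_nilCox (k := k) (n := n)
  have hsq : ∀ {i j : Fin n}, (i : ℕ) + 1 = j → crossAct F i * crossAct F i = 0 := by
    intro i j hij
    refine eq_zero_of_mul_polAct F _ (fun l a => ⟨l, hC.sq_mul_tok hij l a⟩)
      (fun l => ⟨l, hC.sq_mul_dot hij l⟩) fun z => ?_
    rw [Module.End.mul_apply, crossAct_one_tmul F hij, crossAct_one_tmul F hij, ← mul_assoc,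
      hN.sq hij, zero_mul, TensorProduct.tmul_zero]
  refine ⟨hsq, ?_, ?_⟩
  · intro i j l hij hjl
    rw [← sub_eq_zero]
    refine eq_zero_of_mul_polAct F _ (hC.braid_mul_tok hij hjl)
      (hC.braid_mul_dot hij hjl (hsq hij) (hsq hjl)) fun z => ?_
    have e := congrArg (· * z) (hN.braid hij hjl)
    simp only [mul_assoc] at e
    simp only [LinearMap.sub_apply, Module.End.mul_apply, crossAct_one_tmul F hij,
      crossAct_one_tmul F hjl, e, sub_self]
  · intro i i' j j' hi hj hij
    rw [← sub_eq_zero]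
    refine eq_zero_of_mul_polAct F _ (hC.far_mul_tok hi hj hij) (hC.far_mul_dot hi hj hij)
      fun z => ?_
    have e := congrArg (· * z) (hN.far hi hj hij)
    simp only [mul_assoc] at e
    simp only [LinearMap.sub_apply, Module.End.mul_apply, crossAct_one_tmul F hi,
      crossAct_one_tmul F hj, e, sub_self]

/-- The action of the Frobenius nilHecke algebra on the tensor product of the Frobenius polynomial
algebra and the nilCoxeter algebra. -/
noncomputable def nilHeckeAct (n : ℕ) : NilHeckeAlg F n →ₐ[k] Module.End k (PolNilCox F n) :=
  (isModel_nilHeckeVal (isPolSystem_polAct F) (isCrossSystem_crossAct F)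
    (isNilCoxSystem_crossAct F)).lift

theorem nilHeckeAct_tok (l : Fin n) (a : A) :
    nilHeckeAct F n (nilHeckeTok F l a) = polAct F n (polTok l a) :=
  (IsModel.lift_genAt _ l.2 _).trans (nilHeckeVal_token _ _ _ l a)

theorem nilHeckeAct_dot (l : Fin n) :
    nilHeckeAct F n (nilHeckeDot F l) = polAct F n (polDot 𝒜 F.trp l) :=
  (IsModel.lift_genAt _ l.2 _).trans (nilHeckeVal_dot _ _ _ l)

theorem nilHeckeAct_cross {i j : Fin n} (hij : (i : ℕ) + 1 = j) :
    nilHeckeAct F n (nilHeckeCross F i) = crossAct F i :=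
  (IsModel.lift_genAt _ (by omega) _).trans (nilHeckeVal_cross _ _ _ i)

theorem nilHeckeAct_pol (f : PolAlg F n) :
    nilHeckeAct F n (polToNilHecke F n f) = polAct F n f := by
  refine pol_mem_subalgebra
    (AlgHom.equalizer ((nilHeckeAct F n).comp (polToNilHecke F n)) (polAct F n))
    (fun l a => ?_) (fun l => ?_) f
  · change nilHeckeAct F n (polToNilHecke F n (polTok l a)) = _
    rw [polToNilHecke_tok, nilHeckeAct_tok]
  · change nilHeckeAct F n (polToNilHecke F n (polDot 𝒜 F.trp l)) = _
    rw [polToNilHecke_dot, nilHeckeAct_dot]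

/-- A general `y` is needed: in a product the second factor first changes $1\otimes y$ into
$1\otimes z'y$. -/
theorem nilHeckeAct_nilCox (z y : NilCoxAlg (evenGrading k) n) :
    nilHeckeAct F n (nilCoxToNilHecke F n z) (1 ⊗ₜ y) = 1 ⊗ₜ (z * y) := by
  let S : Subalgebra k (NilCoxAlg (evenGrading k) n) :=
    { carrier := {z | ∀ y, nilHeckeAct F n (nilCoxToNilHecke F n z) (1 ⊗ₜ y) = 1 ⊗ₜ (z * y)}
      mul_mem' := fun {z z'} hz hz' y => by
        rw [map_mul, map_mul, Module.End.mul_apply, hz', hz, mul_assoc]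
      add_mem' := fun {z z'} hz hz' y => by
        rw [map_add, map_add, LinearMap.add_apply, hz, hz', add_mul, TensorProduct.tmul_add]
      algebraMap_mem' := fun c y => by
        rw [AlgHom.commutes, AlgHom.commutes, Module.algebraMap_end_apply,
          ← TensorProduct.tmul_smul, Algebra.smul_def] }
  refine nilCox_mem_subalgebra S (fun i j hij y => ?_) z y
  rw [nilCoxToNilHecke_cross F hij, nilHeckeAct_cross F hij, crossAct_one_tmul F hij]

end Action

/-! ### The basis theorem -/

/-- The multiplication map from the tensor product to the Frobenius nilHecke algebra. -/
noncomputable def mulMap (n : ℕ) : PolNilCox F n →ₗ[k] NilHeckeAlg F n :=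
  TensorProduct.lift ((LinearMap.mul k (NilHeckeAlg F n)).compl₁₂
    (polToNilHecke F n).toLinearMap (nilCoxToNilHecke F n).toLinearMap)

theorem mulMap_tmul (f : PolAlg F n) (z : NilCoxAlg (evenGrading k) n) :
    mulMap F n (f ⊗ₜ z) = polToNilHecke F n f * nilCoxToNilHecke F n z := rfl

/-- Acting on $1\otimes1$ is a left inverse: $z$ produces $1\otimes z$, and $f$ then produces
$f\otimes z$. -/
theorem mulMap_injective : Function.Injective (mulMap F n) := by
  refine Function.LeftInverse.injective (g := fun x => nilHeckeAct F n x (1 ⊗ₜ 1)) fun m => ?_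
  beta_reduce
  induction m using TensorProduct.induction_on with
  | zero => simp
  | add x y hx hy => rw [map_add, map_add, LinearMap.add_apply, hx, hy]
  | tmul f z =>
    rw [mulMap_tmul, map_mul, Module.End.mul_apply, nilHeckeAct_nilCox, nilHeckeAct_pol,
      polAct_tmul, mul_one, mul_one]

/-- The elements that preserve the image under left multiplication form a subalgebra containing the
generators, so the image is a left ideal; it contains $1$. -/
theorem mulMap_surjective : Function.Surjective (mulMap F n) := by
  have hcross : IsCrossSystem F (fun l => (polToNilHecke F n).comp (polTok l))
      (fun l => polToNilHecke F n (polDot 𝒜 F.trp l)) (nilHeckeCross F) := by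
    convert isCrossSystem_nilHecke F (n := n) using 1
    · funext l; ext a; exact polToNilHecke_tok F l a
    · funext l; exact polToNilHecke_dot F l
  have hpol : ∀ (f : PolAlg F n) (m : PolNilCox F n), ∃ m',
      mulMap F n m' = polToNilHecke F n f * mulMap F n m := by
    intro f m
    refine ⟨polAct F n f m, ?_⟩
    induction m using TensorProduct.induction_on with
    | zero => simp
    | add x y hx hy => rw [map_add, map_add, map_add, hx, hy, mul_add]
    | tmul g z => rw [polAct_tmul, mulMap_tmul, mulMap_tmul, map_mul, mul_assoc]
  let S : Subalgebra k (NilHeckeAlg F n) :=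
    { carrier := {x | ∀ m, ∃ m', mulMap F n m' = x * mulMap F n m}
      mul_mem' := fun {x y} hx hy m => by
        obtain ⟨m', hm'⟩ := hy m
        obtain ⟨m'', hm''⟩ := hx m'
        exact ⟨m'', by rw [hm'', hm', mul_assoc]⟩
      add_mem' := fun {x y} hx hy m => by
        obtain ⟨m', hm'⟩ := hx m
        obtain ⟨m'', hm''⟩ := hy m
        exact ⟨m' + m'', by rw [map_add, hm', hm'', add_mul]⟩
      algebraMap_mem' := fun c m => ⟨c • m, by rw [map_smul, Algebra.smul_def]⟩ }
  intro x
  have hx : x ∈ S := by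
    refine nilHecke_mem_subalgebra F S (fun l a => ?_) (fun l => ?_) (fun i j hij m => ?_) x
    · rw [← polToNilHecke_tok]; exact hpol _
    · rw [← polToNilHecke_dot]; exact hpol _
    -- The multiplication map intertwines the operator `crossAct` with left multiplication by the
    -- crossing, by `IsCrossSystem.mul_map`.
    · refine ⟨crossAct F i m, ?_⟩
      induction m using TensorProduct.induction_on with
      | zero => simp
      | add x y hx hy => rw [map_add, map_add, map_add, hx, hy, mul_add]
      | tmul f z =>
        rw [crossAct_tmul F hij, map_add, mulMap_tmul, mulMap_tmul, mulMap_tmul, ← mul_assoc,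
          hcross.mul_map (polToNilHecke F n) hij, map_mul, nilCoxToNilHecke_cross F hij, add_mul,
          mul_assoc]
  obtain ⟨m, hm⟩ := hx (1 ⊗ₜ 1)
  exact ⟨m, by rw [hm, mulMap_tmul, map_one, map_one, mul_one, mul_one]⟩

end FrobNH

theorem theorem5 {k : Type u} [CommRing k] {A : Type v} [Ring A] [Algebra k A]
    (𝒜 : ZMod 2 → Submodule k A) [GradedAlgebra 𝒜] {ι : Type w} [Fintype ι]
    (F : FrobNH.SymmetricFrobenius k 𝒜 ι) (n : ℕ) :
    ∃ e : TensorProduct k (FrobNH.PolAlg F n) (FrobNH.NilCoxAlg (FrobNH.evenGrading k) n) ≃ₗ[k]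
        FrobNH.NilHeckeAlg F n,
      ∀ (f : FrobNH.PolAlg F n) (z : FrobNH.NilCoxAlg (FrobNH.evenGrading k) n),
        e (f ⊗ₜ[k] z) = FrobNH.polToNilHecke F n f * FrobNH.nilCoxToNilHecke F n z :=
  ⟨LinearEquiv.ofBijective (FrobNH.mulMap F n)
    ⟨FrobNH.mulMap_injective F, FrobNH.mulMap_surjective F⟩, fun _ _ => rfl⟩
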